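/- Let $(N,h)$ be an $n$-dimensional complex manifold with a Kähler metric, let $q\in N$, and let $z=(z_1,\dots,z_n)$ be holomorphic coordinates of $N$ around $q$; let $a\in\mathbb C^n$ be the coordinates of $q$. **Definitions.** If $h$ has near $q$ a real analytic Kähler potential $\psi$ (that is, $h_{j\bar k}=\partial^2\psi/\partial z_j\partial\bar z_k$) and $\tilde\psi(z,w)$ is its complex analytic extension near $(a,\bar a)$, so $\tilde\psi(z,\bar z)=\psi(z)$, then Calabi's diastasis of $h$ centred at $q$ is the germ $D_q^h(z)=\tilde\psi(z,\bar z)+\tilde\psi(a,\bar a)-\tilde\psi(z,\bar a)-\tilde\psi(a,\bar z)$. Let $\mathcal F$ be the set of germs at $a$ of real functions $\xi(f_1,\dots,f_k)$, $k>0$, where $f_1,\dots,f_k$ are germs at $a$ of holomorphic functions, $\xi:V\to\mathbb R$ is defined on an open set $V\subset\mathbb C^k$ containing $(f_1(a),\dots,f_k(a))$, and $\xi(x)=\tilde\xi(x,\bar x)$ on $V$ for a holomorphic Nash algebraic function $\tilde\xi$ on a neighbourhood of $\{(x,\bar x):x\in V\}$ in $\mathbb C^k\times\mathbb C^k$ (Nash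 algebraic: holomorphic and, near each point, a root of a nonzero polynomial in one variable with coefficients in $\mathbb C[x,y]$). Let $\tilde{\mathcal F}\subset\mathcal F$ be the subset of functions of diastasis-type, i.e. those whose power series in $z-a$ and $\bar z-\bar a$ contains no nonconstant purely holomorphic or purely antiholomorphic terms. **Statement.** Suppose that near $q$ $$D_q^h(z)=\Psi(z)+\log\bigl(\psi_1(z)^{\gamma_1}\cdots\psi_r(z)^{\gamma_r}\bigr),$$ where $r\ge 0$, $\gamma_1,\dots,\gamma_r\in\mathbb R$, $\psi_1,\dots,\psi_r\in\tilde{\mathcal F}$ are positive near $q$, and $\Psi\in\tilde{\mathcal F}$ is strictly plurisubharmonic at $q$ (its Levi form $\left(\partial^2\Psi/\partial z_j\partial\bar z_k\right)(a)$ is positive definite). Let $(M,g)$ be a Kähler–Einstein submanifold of $(N,h)$ passing through $q$: $M$ is a complex manifold with a Kähler metric $g$ whose Ricci tensor $-\partial^2\log\det(g_{a\bar b})/\partial w_j\partial\bar w_k$ equals $\lambda g_{j\bar k}$ in all holomorphic coordinates $w$ for one constant $\lambda\in\mathbb R$, and there is a holomorphic map $f:M\to N$ with $f^*h=g$ and $q\in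 f(M)$. Then $(M,g)$ is Ricci-flat. -/

import Mathlib

open scoped Manifold ContDiff Topology

noncomputable section

/-- The coordinate space `ℂⁿ`, the model space of complex manifolds of dimension `n`
(only its topological vector space structure is used). -/
abbrev CSpace (n : ℕ) : Type := Fin n → ℂ

/-! ### Wirtinger derivatives -/

/-- The Wirtinger derivative `∂F/∂z_j = (∂F/∂x_j - i ∂F/∂y_j) / 2`. -/
def wirtingerDz {n : ℕ} (j : Fin n) (F : CSpace n → ℂ) (z : CSpace n) : ℂ :=
  (fderiv ℝ F z (Pi.single j 1) - Complex.I * fderiv ℝ F z (Pi.single j Complex.I)) / 2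

/-- The Wirtinger derivative `∂F/∂z̄_j = (∂F/∂x_j + i ∂F/∂y_j) / 2`. -/
def wirtingerDzbar {n : ℕ} (j : Fin n) (F : CSpace n → ℂ) (z : CSpace n) : ℂ :=
  (fderiv ℝ F z (Pi.single j 1) + Complex.I * fderiv ℝ F z (Pi.single j Complex.I)) / 2

/-- The complex Hessian (Levi matrix) `(∂²u/∂z_j∂z̄_k)_{jk}` of a real function `u` at `z`. -/
def complexHessian {n : ℕ} (u : CSpace n → ℝ) (z : CSpace n) : Matrix (Fin n) (Fin n) ℂ :=
  Matrix.of fun j k => wirtingerDz j (wirtingerDzbar k (fun y => (u y : ℂ))) z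

/-- `u` is strictly plurisubharmonic at `a`: it is `C²` near `a` and its Levi form at `a` is
positive definite. -/
def StrictlyPlurisubharmonicAt {n : ℕ} (u : CSpace n → ℝ) (a : CSpace n) : Prop :=
  ContDiffAt ℝ 2 u a ∧
    ∀ v : CSpace n, v ≠ 0 → 0 < (∑ j, ∑ k, complexHessian u a j k * v j * star (v k)).re

/-! ### Kähler metrics on complex manifolds -/

section Kahler

variable (n : ℕ) (N : Type*) [TopologicalSpace N] [ChartedSpace (CSpace n) N]

/-- The holomorphic coordinate systems of the complex manifold `N`. -/
abbrev HolomorphicCharts : Set (OpenPartialHomeomorph N (CSpace n)) :=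
  IsManifold.maximalAtlas 𝓘(ℂ, CSpace n) ω N

/-- A field of sesquilinear forms on the holomorphic tangent spaces (linear in the first and
conjugate-linear in the second argument). -/
abbrev SesquilinearField : Type _ :=
  ∀ x : N, TangentSpace 𝓘(ℂ, CSpace n) x →ₗ[ℂ] TangentSpace 𝓘(ℂ, CSpace n) x →ₗ⋆[ℂ] ℂ

variable {n N}

/-- The matrix `h_{jk̄} = h(∂/∂z_j, ∂/∂z_k)` of a field of sesquilinear forms in the coordinate
system `φ`, as a function on the image of `φ` (the vector `∂/∂z_j` at the point with coordinates
`y` is the image of the `j`-th basis vector under the differential of `φ⁻¹`). -/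
def SesquilinearField.matrix (h : SesquilinearField n N)
    (φ : OpenPartialHomeomorph N (CSpace n)) (y : CSpace n) : Matrix (Fin n) (Fin n) ℂ :=
  Matrix.of fun j k => h (φ.symm y)
    (mfderiv 𝓘(ℂ, CSpace n) 𝓘(ℂ, CSpace n) φ.symm y (Pi.single j (1 : ℂ) : CSpace n))
    (mfderiv 𝓘(ℂ, CSpace n) 𝓘(ℂ, CSpace n) φ.symm y (Pi.single k (1 : ℂ) : CSpace n))

variable (n N)

/-- A Kähler metric: a smooth Hermitian metric `h` whose fundamental form
`(i/2) ∑ h_{jk̄} dz_j ∧ dz̄_k` is closed, i.e. `∂h_{jk̄}/∂z_l = ∂h_{lk̄}/∂z_j`. -/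
structure KahlerMetric where
  form : SesquilinearField n N
  hermitian : ∀ (x : N) (u v : TangentSpace 𝓘(ℂ, CSpace n) x),
    form x u v = starRingEnd ℂ (form x v u)
  pos : ∀ (x : N) (u : TangentSpace 𝓘(ℂ, CSpace n) x), u ≠ 0 → 0 < (form x u u).re
  smooth : ∀ φ ∈ HolomorphicCharts n N, ∀ j k : Fin n,
    ContDiffOn ℝ ∞ (fun y => form.matrix φ y j k) φ.target
  closed : ∀ φ ∈ HolomorphicCharts n N, ∀ y ∈ φ.target, ∀ j k l : Fin n,
    wirtingerDz l (fun y => form.matrix φ y j k) y =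
      wirtingerDz j (fun y => form.matrix φ y l k) y

variable {n N}

/-- The Ricci tensor `R_{jk̄} = - ∂²/∂z_j∂z̄_k log det (h_{ab̄})` in the coordinate system `φ`. -/
def KahlerMetric.ricci (h : KahlerMetric n N)
    (φ : OpenPartialHomeomorph N (CSpace n)) (y : CSpace n) : Matrix (Fin n) (Fin n) ℂ :=
  -complexHessian (fun x => Real.log (h.form.matrix φ x).det.re) y

/-- `h` is Kähler–Einstein: its Ricci tensor is a constant multiple of the metric. -/
def KahlerMetric.IsKahlerEinstein (h : KahlerMetric n N) : Prop :=
  ∃ c : ℝ, ∀ φ ∈ HolomorphicCharts n N, ∀ y ∈ φ.target,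
    h.ricci φ y = (c : ℂ) • h.form.matrix φ y

/-- `h` is Ricci-flat: its Ricci tensor vanishes identically. -/
def KahlerMetric.IsRicciFlat (h : KahlerMetric n N) : Prop :=
  ∀ φ ∈ HolomorphicCharts n N, ∀ y ∈ φ.target, h.ricci φ y = 0

/-- A holomorphic isometry (Kähler immersion) `f : (M, g) → (N, h)`: a holomorphic map with
`f^* h = g`. -/
def IsHolomorphicIsometry {m : ℕ} {M : Type*} [TopologicalSpace M] [ChartedSpace (CSpace m) M]
    (g : KahlerMetric m M) (h : KahlerMetric n N) (f : M → N) : Prop :=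
  ContMDiff 𝓘(ℂ, CSpace m) 𝓘(ℂ, CSpace n) ω f ∧
  ∀ (x : M) (u v : TangentSpace 𝓘(ℂ, CSpace m) x),
    g.form x u v = h.form (f x)
      (mfderiv 𝓘(ℂ, CSpace m) 𝓘(ℂ, CSpace n) f x u)
      (mfderiv 𝓘(ℂ, CSpace m) 𝓘(ℂ, CSpace n) f x v)

end Kahler

/-! ### Calabi's diastasis function -/

/-- `T` is a complex analytic extension of the real function `u` near `a`, obtained by duplicating
the variables `z` and `z̄`: it is holomorphic near `(a, ā)`, and `T(z, z̄) = u(z)` for `z` near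
`a`. -/
def IsComplexExtensionAt {n : ℕ} (u : CSpace n → ℝ) (T : CSpace n × CSpace n → ℂ)
    (a : CSpace n) : Prop :=
  AnalyticAt ℂ T (a, star a) ∧ ∀ᶠ z in 𝓝 a, T (z, star z) = (u z : ℂ)

/-- `D`, a function of the coordinates `φ`, is near `q` Calabi's diastasis function of `h` centred
at `q`: with a Kähler potential `u` of `h` near `q` and its complex analytic extension `T`,
`D(z) = T(z, z̄) + T(q, q̄) - T(z, q̄) - T(q, z̄)`. -/
def KahlerMetric.IsDiastasisAt {n : ℕ} {N : Type*} [TopologicalSpace N]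
    [ChartedSpace (CSpace n) N] (h : KahlerMetric n N) (q : N)
    (φ : OpenPartialHomeomorph N (CSpace n)) (D : CSpace n → ℝ) : Prop :=
  ∃ (u : CSpace n → ℝ) (T : CSpace n × CSpace n → ℂ),
    (∀ᶠ z in 𝓝 (φ q), h.form.matrix φ z = complexHessian u z) ∧
    IsComplexExtensionAt u T (φ q) ∧
    ∀ᶠ z in 𝓝 (φ q), (D z : ℂ) =
      T (z, star z) + T (φ q, star (φ q)) - T (z, star (φ q)) - T (φ q, star z)

/-! ### Nash functions and the class of diastasis-type Nash functions -/

/-- `F` is a holomorphic Nash algebraic function on `Ω ⊆ ℂᵏ × ℂᵏ`: it is holomorphic and, near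
each point of `Ω`, satisfies a nontrivial polynomial equation `P(z, w; F(z, w)) = 0` with
coefficients polynomial in the variables `(z, w)`. -/
def IsHolomorphicNashOn {k : ℕ} (F : CSpace k × CSpace k → ℂ)
    (Ω : Set (CSpace k × CSpace k)) : Prop :=
  ∀ x ∈ Ω, AnalyticAt ℂ F x ∧
    ∃ P : Polynomial (MvPolynomial (Fin k ⊕ Fin k) ℂ), P ≠ 0 ∧
      ∀ᶠ y in 𝓝 x, P.eval₂ (MvPolynomial.eval (Sum.elim y.1 y.2)) (F y) = 0

/-- The real analytic functions `ξ : V → ℝ`, `V ⊆ ℂᵏ` open, whose complex analytic extension to a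
neighbourhood of the diagonal `{(z, z̄)}` of `V × Conj V` is a holomorphic Nash algebraic
function. -/
def IsRealNashOn {k : ℕ} (ξ : CSpace k → ℝ) (V : Set (CSpace k)) : Prop :=
  IsOpen V ∧ ∃ (Ω : Set (CSpace k × CSpace k)) (F : CSpace k × CSpace k → ℂ),
    IsOpen Ω ∧ (∀ z ∈ V, (z, star z) ∈ Ω) ∧ IsHolomorphicNashOn F Ω ∧
    ∀ z ∈ V, F (z, star z) = (ξ z : ℂ)

/-- The class `𝓕` at `a ∈ ℂⁿ`: germs at `a` of functions `ξ(f₁, …, f_k)`, `k > 0`, where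
`f₁, …, f_k` are germs of holomorphic functions at `a` and `ξ` is a real Nash function defined on
an open set containing `(f₁(a), …, f_k(a))`. -/
def NashClass (n : ℕ) (a : CSpace n) : Set (CSpace n → ℝ) :=
  {ψ | ∃ (k : ℕ) (V : Set (CSpace k)) (ξ : CSpace k → ℝ) (f : Fin k → CSpace n → ℂ),
    0 < k ∧ IsRealNashOn ξ V ∧ (∀ i, AnalyticAt ℂ (f i) a) ∧ (fun i => f i a) ∈ V ∧
    ∀ᶠ z in 𝓝 a, ψ z = ξ (fun i => f i z)}

/-- `u` is of diastasis-type at `a`: it is real analytic near `a` and its power series in `z - a`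
and `z̄ - ā` has no nonconstant purely holomorphic or purely antiholomorphic terms. These terms
are the ones of the power series in `z - a`, resp. `w - ā`, of `T(z, ā)`, resp. `T(a, w)`, where
`T(z, w)` is the complex analytic extension. -/
def IsDiastasisType {n : ℕ} (u : CSpace n → ℝ) (a : CSpace n) : Prop :=
  ∃ T : CSpace n × CSpace n → ℂ, IsComplexExtensionAt u T a ∧
    (∀ᶠ z in 𝓝 a, T (z, star a) = T (a, star a)) ∧
    (∀ᶠ w in 𝓝 (star a), T (a, w) = T (a, star a))

/-- The class `𝓕̃` at `a`: the functions of diastasis-type in `𝓕`. -/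
def NashDiastasisClass (n : ℕ) (a : CSpace n) : Set (CSpace n → ℝ) :=
  {ψ | ψ ∈ NashClass n a ∧ IsDiastasisType ψ a}

end

/-!
Suppose that the Einstein constant `c` of `g` is not zero. Let `F` be the map `f` in holomorphic
coordinates around a point over `q`, and let `B(z, w)` be the complex extension of the diastasis,
pulled back by `F`. It is the sum of `Φ`, coming from `Ψ`, and of `∑ γ i * log (A i)`, coming from
the `ψ i`. The metric `g` has the matrix `∂²B/∂z∂w` at `w = z̄`; let `Δ(z, w)` be its determinant.
The Einstein equation says that the mixed derivatives of `log Δ + c * B` vanish for `w = z̄`, hence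
for all `z, w` by polarization (`AnalyticAt.eventually_eq_zero_of_star`). Along a line `(t, s)` in
the `(z, w)`-space this means that

  `∂Φ/∂s + ∑ γ i * ∂(log A i)/∂s + c⁻¹ * ∂(log Δ)/∂s`

is a function of `s` alone. Moreover `Φ(t, 0)` is constant, since `Ψ` is of diastasis-type, while
`∂²Φ/∂t∂s` is not zero at the origin, since `Ψ` is strictly plurisubharmonic and `F` an immersion.

The functions `Φ`, `A i` and `Δ` are algebraic over the functions of the form `∑ a(t) * b(s)`:
this is what the Nash property gives (`isSepAlgebraic_nash`). The Nash functions are evaluated at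
functions of `t` alone or `s` alone, and the polynomial equation they satisfy, which may degenerate
along these functions, is saved by a homotopy to a generic constant (`isAlgebraic_nash`). For `Δ` one
needs the same for derivatives transversal to the line, which are coefficients of the expansion in
a further variable (`coeff_mem_of_isAlgebraic`).

It remains to refute such an equation, and this is pure algebra (`isAlgebraic_coeff_one`). Expand in
powers of `s`. If the coefficient `∂Φ/∂s` at `s = 0`, a function of `t`, is not constant, then it is
transcendental over `ℂ`, and the field of germs of meromorphic functions of `t` has a derivation `D`
that takes the value `1` there and has constants so large that the field is algebraic over the
constants and this one element (`exists_derivation_of_transcendental`). Applying `D` to the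
coefficients in the equation and integrating in `s`, one finds that `DΦ` is a linear combination of
logarithmic `D`-derivatives, in a field of transcendence degree one over its constants. By
the theorem of Ostrowski and Rosenlicht (`Derivation.eq_zero_of_eq_sum_logDeriv`) this forces
`DΦ = 0`, a contradiction. So `∂Φ/∂s` is constant along `s = 0`, against
`∂²Φ/∂t∂s ≠ 0`.
-/

noncomputable section

section derivations

open Polynomial

/-! ### Derivations of fields of characteristic zero -/

/-- Derivations extend along formally étale extensions. -/
theorem exists_derivation_extension {R A B : Type*} [CommRing R] [CommRing A] [CommRing B]
    [Algebra R A] [Algebra R B] [Algebra A B] [IsScalarTower R A B] [Algebra.FormallyEtale A B]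
    (d : Derivation R A B) : ∃ D : Derivation R B B, ∀ a, D (algebraMap A B a) = d a := by
  let e := KaehlerDifferential.tensorKaehlerEquivOfFormallyEtale R A B
  let l : TensorProduct A B (Ω[A⁄R]) →ₗ[B] B := TensorProduct.AlgebraTensorModule.lift
    ((LinearMap.ringLmapEquivSelf B B (Ω[A⁄R] →ₗ[A] B)).symm d.liftKaehlerDifferential)
  refine ⟨(l ∘ₗ e.symm.toLinearMap).compDer (KaehlerDifferential.D R B), fun a => ?_⟩
  have h1 : e.symm (KaehlerDifferential.D R B (algebraMap A B a)) = _ :=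
    KaehlerDifferential.tensorKaehlerEquivOfFormallyEtale_symm_D_algebraMap R A B a
  change l (e.symm (KaehlerDifferential.D R B (algebraMap A B a))) = d a
  rw [h1]
  simp [l]

/-- In characteristic zero, a field that is algebraic over a domain is formally étale over it: it is
separable over the field of fractions. -/
theorem formallyEtale_of_isAlgebraic (A B : Type*) [CommRing A] [IsDomain A] [CharZero A] [Field B]
    [Algebra A B] [FaithfulSMul A B] [Algebra.IsAlgebraic A B] : Algebra.FormallyEtale A B := by
  let K := FractionRing A
  let _ : Algebra K B := FractionRing.liftAlgebra A B
  have : IsScalarTower A K B := FractionRing.isScalarTower_liftAlgebra A B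
  have : Algebra.IsAlgebraic K B := IsFractionRing.comap_isAlgebraic_iff.mp ‹Algebra.IsAlgebraic A B›
  have : CharZero K := inferInstance
  have : Algebra.IsSeparable K B := inferInstance
  have : Algebra.FormallyEtale K B := Algebra.FormallyEtale.of_isSeparable K B
  have : Algebra.FormallyEtale A K := Algebra.FormallyEtale.of_isLocalization (nonZeroDivisors A)
  exact Algebra.FormallyEtale.comp A K B

/-- The subfield of constants of a derivation. -/
def Derivation.constants {k F : Type*} [Field k] [Field F] [Algebra k F] (D : Derivation k F F) :
    IntermediateField k F where
  carrier := {y | D y = 0}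
  mul_mem' {a b} ha hb := by simp_all
  add_mem' {a b} ha hb := by simp_all
  algebraMap_mem' r := by simp
  inv_mem' a ha := by simp_all [Derivation.leibniz_inv]

theorem Derivation.mem_constants {k F : Type*} [Field k] [Field F] [Algebra k F]
    (D : Derivation k F F) {y : F} : y ∈ D.constants ↔ D y = 0 := Iff.rfl

/-- A derivation vanishes on the elements that are algebraic over its constants. -/
theorem Derivation.eq_zero_of_isAlgebraic {k F : Type*} [Field k] [Field F] [CharZero F] [Algebra k F]
    (D : Derivation k F F) {y : F} (hy : IsAlgebraic D.constants y) : D y = 0 := by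
  let D' : Derivation D.constants F F :=
    { D.toLinearMap with
      map_smul' := fun c y => by
        have : D c = 0 := c.2
        simp [Algebra.smul_def, this]
      map_one_eq_zero' := D.map_one_eq_zero
      leibniz' := fun a b => D.leibniz a b }
  have h := D'.map_aeval (minpoly D.constants y) y
  rw [minpoly.aeval, map_zero] at h
  have hs : (minpoly D.constants y).Separable := (minpoly.irreducible hy.isIntegral).separable
  have h2 : aeval y (derivative (minpoly D.constants y)) ≠ 0 :=
    hs.aeval_derivative_ne_zero (minpoly.aeval _ _)
  have h3 : D' y = D y := rfl
  rw [← h3]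
  simpa [h2] using h.symm

/-- Every transcendental `x` admits a derivation with value `1` at `x` whose constants are so many
that a relatively algebraically closed subfield containing them and `x` is everything. -/
theorem exists_derivation_of_transcendental {k F : Type*} [Field k] [Field F] [CharZero k]
    [Algebra k F] {x : F} (hx : Transcendental k x) :
    ∃ D : Derivation k F F, D x = 1 ∧ ∀ K : IntermediateField k F, D.constants ≤ K → x ∈ K →
      (∀ y, IsAlgebraic K y → y ∈ K) → ∀ y, y ∈ K := by
  classical
  obtain ⟨s, hxs, hs⟩ := exists_isTranscendenceBasis_superset (R := k) (A := F) (s := {x})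
    ((algebraicIndependent_unique_type_iff (ι := ({x} : Set F))).mpr hx)
  have hxs : x ∈ s := hxs rfl
  have hs' := hs.isAlgebraic
  -- `F` is formally étale over the polynomial ring in a transcendence basis containing `x`;
  -- extend the partial derivative with respect to `x`
  let A := MvPolynomial s k
  let e : A ≃ₐ[k] Algebra.adjoin k (Set.range ((↑) : s → F)) := hs.1.aevalEquiv
  let _ : Algebra A F := (MvPolynomial.aeval (Subtype.val : s → F)).toAlgebra
  have hmap : ∀ p : A, algebraMap A F p = MvPolynomial.aeval (Subtype.val : s → F) p :=
    fun _ => rfl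
  have : IsScalarTower k A F := IsScalarTower.of_algebraMap_eq fun r => by simp [hmap, A]
  have : FaithfulSMul A F := (faithfulSMul_iff_algebraMap_injective A F).mpr hs.1
  have : CharZero A := inferInstanceAs (CharZero (MvPolynomial s k))
  have : Algebra.IsAlgebraic A F := ⟨fun y =>
    IsAlgebraic.of_ringHom_of_comp_eq e.toRingEquiv (RingHom.id F) (hs'.isAlgebraic y)
      e.surjective Function.injective_id rfl⟩
  have := formallyEtale_of_isAlgebraic A F
  obtain ⟨D, hD⟩ := exists_derivation_extension (MvPolynomial.mkDerivation k
    (fun i : s => if (i : F) = x then (1 : F) else 0) : Derivation k A F)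
  have hDs : ∀ i : s, D i = if (i : F) = x then (1 : F) else 0 := fun i => by
    have := hD (MvPolynomial.X i)
    rwa [hmap, MvPolynomial.aeval_X, MvPolynomial.mkDerivation_X] at this
  refine ⟨D, by simpa using hDs ⟨x, hxs⟩, fun K hK hxK hK' y => hK' y ?_⟩
  have hle : Algebra.adjoin k (Set.range ((↑) : s → F)) ≤ K.toSubalgebra := by
    refine Algebra.adjoin_le ?_
    rintro _ ⟨i, rfl⟩
    by_cases hi : (i : F) = x
    · simpa [hi] using hxK
    · exact hK (by simpa [hi] using hDs i : D i = 0)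
  exact (hs'.isAlgebraic y).ringHom_of_comp_eq (Subalgebra.inclusion hle).toRingHom (RingHom.id F)
    (Subalgebra.inclusion_injective hle) rfl

/-- In transcendence degree one, every transcendental element is a transcendence basis. The proof is the
exchange property of the algebraic independence matroid. -/
theorem isAlgebraic_adjoin_exchange {C L : Type*} [Field C] [Field L] [Algebra C L] {x u : L}
    (hu : IsAlgebraic (Algebra.adjoin C {x}) u) (hu' : Transcendental C u) {y : L}
    (hy : IsAlgebraic (Algebra.adjoin C {x}) y) : IsAlgebraic (Algebra.adjoin C {u}) y := by
  have key : ∀ (s : Set L) (z : L), z ∈ (AlgebraicIndependent.matroid C L).closure s ↔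
      IsAlgebraic (Algebra.adjoin C s) z := fun s z => by
    rw [AlgebraicIndependent.matroid_closure_eq]; rfl
  rw [← key] at hu hy ⊢
  have h0 : u ∉ (AlgebraicIndependent.matroid C L).closure ∅ := by
    rw [key, Algebra.adjoin_empty]
    intro h
    exact hu' (IsAlgebraic.of_ringHom_of_comp_eq (Algebra.botEquiv C L).symm.toRingEquiv
      (RingHom.id L) h (Algebra.botEquiv C L).symm.surjective Function.injective_id rfl)
  have := Matroid.closure_insert_congr (X := ∅) ⟨by simpa using hu, h0⟩
  rw [← Set.singleton_def, ← Set.singleton_def] at this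
  rwa [this]

/-! ### Logarithmic derivatives of algebraic elements -/

open Differential in
/-- The Galois case of `logDeriv_sum_descent`, where the new arguments are the norms. -/
theorem logDeriv_sum_descent_of_isGalois {K L ι : Type*} [Field K] [Field L] [Differential K]
    [Differential L] [Algebra K L] [DifferentialAlgebra K L] [CharZero K] [FiniteDimensional K L]
    [IsGalois K L] [Fintype ι] (a : K) (c : ι → K) (u : ι → L)
    (h : algebraMap K L a = ∑ i, algebraMap K L (c i) * logDeriv (u i)) :
    ∃ (d : ℕ) (N : ι → K), d ≠ 0 ∧ d * a = ∑ i, c i * logDeriv (N i) := by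
  have : ∀ i, ∏ σ : (L ≃ₐ[K] L), σ (u i) ∈ IntermediateField.fixedField (⊤ : Subgroup (L ≃ₐ[K] L)) := by
    rintro i ⟨e, _⟩
    change e _ = _
    simp only [map_prod]
    exact Fintype.prod_equiv (Equiv.mulLeft e) _ _ (by simp)
  have ffb : IntermediateField.fixedField (⊤ : Subgroup (L ≃ₐ[K] L)) = ⊥ :=
    (IsGalois.tfae.out 0 1).mp (inferInstance : IsGalois K L)
  simp_rw [ffb, IntermediateField.mem_bot, Set.mem_range] at this
  choose N hN using this
  refine ⟨Fintype.card (L ≃ₐ[K] L), N, Fintype.card_ne_zero, ?_⟩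
  apply FaithfulSMul.algebraMap_injective K L
  have hl : ∀ i, logDeriv (∏ σ : (L ≃ₐ[K] L), σ (u i)) = ∑ σ : (L ≃ₐ[K] L), σ (logDeriv (u i)) := by
    intro i
    by_cases hi : u i = 0
    · simp [hi]
    · rw [logDeriv_prod _ _ _ (by simp [hi])]
      simp [Differential.logDeriv, algEquiv_deriv']
  simp only [map_sum, map_mul, ← logDeriv_algebraMap, hN, hl, map_natCast]
  simp_rw [Finset.mul_sum]
  rw [Finset.sum_comm]
  trans ∑ σ : (L ≃ₐ[K] L), σ (algebraMap K L a)
  · simp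
  · refine Finset.sum_congr rfl fun σ _ => ?_
    rw [h]
    simp

open Differential in
/-- A combination of logarithmic derivatives of algebraic elements that lies in the ground field is, up
to a positive integer factor, such a combination with arguments in the ground field: embed everything
into a finite Galois extension and replace the arguments by their norms. -/
theorem logDeriv_sum_descent {K L ι : Type*} [Field K] [Field L] [Differential K]
    [Differential L] [Algebra K L] [DifferentialAlgebra K L] [CharZero K]
    [Fintype ι] (a : K) (c : ι → K) (u : ι → L) (hu : ∀ i, IsAlgebraic K (u i))
    (h : algebraMap K L a = ∑ i, algebraMap K L (c i) * logDeriv (u i)) :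
    ∃ (d : ℕ) (N : ι → K), d ≠ 0 ∧ d * a = ∑ i, c i * logDeriv (N i) := by
  let B : IntermediateField K L := IntermediateField.adjoin K (Set.range u)
  have : FiniteDimensional K B := IntermediateField.finiteDimensional_adjoin
    (by rintro _ ⟨i, rfl⟩; exact (hu i).isIntegral)
  let v : ι → B := fun i => ⟨u i, IntermediateField.subset_adjoin _ _ ⟨i, rfl⟩⟩
  have hB : algebraMap K B a = ∑ i, algebraMap K B (c i) * logDeriv (v i) := by
    apply FaithfulSMul.algebraMap_injective B L
    simp only [map_sum, map_mul, ← logDeriv_algebraMap, ← IsScalarTower.algebraMap_apply]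
    exact h
  -- `M` is the normal closure of the field generated by the `u i`
  let f : B →ₐ[K] AlgebraicClosure K := IsAlgClosed.lift
  let K' := f.fieldRange
  have : FiniteDimensional K K' := LinearMap.finiteDimensional_range f.toLinearMap
  let M := IntermediateField.normalClosure K K' (AlgebraicClosure K)
  let g : B →ₐ[K] M :=
    (IntermediateField.inclusion (IntermediateField.le_normalClosure K')).comp f.rangeRestrict
  have : FiniteDimensional K M := inferInstance
  have : IsGalois K M := { }
  refine logDeriv_sum_descent_of_isGalois (L := M) a c (fun i => g (v i)) ?_
  have := congrArg g hB
  simpa [Differential.logDeriv, algHom_deriv' g g.injective] using this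

/-- A partial fractions bound: a combination of logarithmic derivatives of polynomials has negative
degree, hence is not a nonzero constant. -/
theorem Polynomial.const_mul_prod_ne_sum {C ι : Type*} [Field C] [Fintype ι] [DecidableEq ι] {d : C}
    (hd : d ≠ 0) (c : ι → C) (p : ι → C[X]) (hp : ∀ i, p i ≠ 0) :
    Polynomial.C d * ∏ i, p i ≠
      ∑ i, Polynomial.C (c i) * (derivative (p i) * ∏ j ∈ Finset.univ.erase i, p j) := by
  intro h
  have h0 : ∏ i, p i ≠ 0 := Finset.prod_ne_zero_iff.mpr fun i _ => hp i
  have h1 : (Polynomial.C d * ∏ i, p i).degree = (∏ i, p i).degree := degree_C_mul hd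
  have h2 : (∑ i, Polynomial.C (c i) *
      (derivative (p i) * ∏ j ∈ Finset.univ.erase i, p j)).degree < (∏ i, p i).degree := by
    refine lt_of_le_of_lt (degree_sum_le _ _) ?_
    rw [Finset.sup_lt_iff (bot_lt_iff_ne_bot.mpr (degree_ne_bot.mpr h0))]
    intro i _
    rw [← Polynomial.smul_eq_C_mul]
    refine lt_of_le_of_lt (degree_smul_le _ _) ?_
    rw [← Finset.mul_prod_erase Finset.univ p (Finset.mem_univ i), degree_mul, degree_mul]
    have h3 : (∏ j ∈ Finset.univ.erase i, p j) ≠ 0 := Finset.prod_ne_zero_iff.mpr fun i _ => hp i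
    exact WithBot.add_lt_add_right (degree_ne_bot.mpr h3) (degree_derivative_lt (hp i))
  rw [← h1, h] at h2
  exact lt_irrefl _ h2

/-- **Ostrowski–Rosenlicht**: over a field of constants, in transcendence degree one, the
derivative of an element is not a combination of logarithmic derivatives unless it vanishes. -/
theorem Derivation.eq_zero_of_eq_sum_logDeriv {k L ι : Type*} [Field k] [Field L] [CharZero L]
    [Algebra k L] [Fintype ι] (D : Derivation k L L) (x u : L) (c : ι → L) (v : ι → L)
    (hu : IsAlgebraic (Algebra.adjoin D.constants {x}) u)
    (hv : ∀ i, IsAlgebraic (Algebra.adjoin D.constants {x}) (v i))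
    (hc : ∀ i, D (c i) = 0) (h : D u = ∑ i, c i * (D (v i) / v i)) : D u = 0 := by
  classical
  by_contra hDu
  -- if `D u ≠ 0`, normalize the derivation so that `u` becomes an independent variable
  have hu' : Transcendental D.constants u := fun h => hDu (D.eq_zero_of_isAlgebraic h)
  replace hv := fun i => isAlgebraic_adjoin_exchange hu hu' (hv i)
  let δ : Derivation k L L := (D u)⁻¹ • D
  have hδ : ∀ y, δ y = (D u)⁻¹ * D y := fun y => rfl
  have hδu : δ u = 1 := by rw [hδ, inv_mul_cancel₀ hDu]
  have hδC : ∀ y : D.constants, δ y = 0 := fun y => by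
    rw [hδ, (D.mem_constants).mp y.2, mul_zero]
  let _ : Differential L := ⟨δ.restrictScalars ℤ⟩
  have hL : ∀ y : L, Differential.deriv y = δ y := fun y => rfl
  let K := IntermediateField.adjoin D.constants {u}
  have hpoly : ∀ p : D.constants[X], δ (aeval u p) = aeval u (derivative p) := by
    intro p
    induction p using Polynomial.induction_on' with
    | add p q hp hq => simp [hp, hq]
    | monomial n a =>
      have ha : δ (algebraMap D.constants L a) = 0 := hδC a
      rw [aeval_monomial, Derivation.leibniz, ha, Derivation.leibniz_pow, hδu, derivative_monomial,
        aeval_monomial]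
      simp [mul_assoc]
  have hKmem : ∀ p : D.constants[X], aeval u p ∈ K := fun p => by
    have : aeval (⟨u, IntermediateField.mem_adjoin_simple_self _ u⟩ : K) p = aeval u p := by
      rw [← IntermediateField.aeval_coe]
    rw [← this]
    exact Subtype.mem _
  have hK : ∀ y ∈ K, δ y ∈ K := by
    intro y hy
    obtain ⟨p, q, rfl⟩ := (IntermediateField.mem_adjoin_simple_iff _ _).mp hy
    rw [Derivation.leibniz_div, hpoly, hpoly]
    simp only [smul_eq_mul]
    exact mul_mem (pow_mem (inv_mem (hKmem _)) _)
      (sub_mem (mul_mem (hKmem _) (hKmem _)) (mul_mem (hKmem _) (hKmem _)))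
  let _ : Differential K := ⟨Derivation.mk'
    { toFun := fun y => ⟨δ y, hK y y.2⟩
      map_add' := fun a b => Subtype.ext (by simp)
      map_smul' := fun n a => Subtype.ext (by simp) } (fun a b => Subtype.ext (by simp))⟩
  have : DifferentialAlgebra K L := ⟨fun a => rfl⟩
  -- take norms down to the field of rational functions in `u` over the constants
  let c' : ι → D.constants := fun i => ⟨c i, hc i⟩
  obtain ⟨d, N, hd, hN⟩ := logDeriv_sum_descent (K := K) (1 : K)
    (fun i => algebraMap D.constants K (c' i)) v
    (fun i => (hv i).ringHom_of_comp_eq (Subalgebra.inclusion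
      (IntermediateField.algebra_adjoin_le_adjoin D.constants {u})).toRingHom (RingHom.id L)
      (Subalgebra.inclusion_injective _) rfl) (by
      rw [_root_.map_one, ← hδu, hδ]
      nth_rewrite 2 [h]
      rw [Finset.mul_sum]
      refine Finset.sum_congr rfl fun i _ => ?_
      rw [← IsScalarTower.algebraMap_apply]
      change _ = c i * (δ (v i) / v i)
      rw [hδ]
      ring)
  -- logarithmic derivatives of rational functions of `u` are differences of those of polynomials
  have hrat : ∀ y : K, ∃ p q : D.constants[X], p ≠ 0 ∧ q ≠ 0 ∧
      algebraMap K L (Differential.logDeriv y) =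
        aeval u (derivative p) / aeval u p - aeval u (derivative q) / aeval u q := by
    intro y
    rcases eq_or_ne y 0 with rfl | hy
    · exact ⟨1, 1, by simp⟩
    obtain ⟨p, q, hpq⟩ := (IntermediateField.mem_adjoin_simple_iff _ _).mp y.2
    have hy' : (y : L) ≠ 0 := by simpa using hy
    have hp : aeval u p ≠ 0 := fun h => hy' (by rw [hpq, h, zero_div])
    have hq : aeval u q ≠ 0 := fun h => hy' (by rw [hpq, h, div_zero])
    refine ⟨p, q, fun h => hp (by simp [h]), fun h => hq (by simp [h]), ?_⟩
    rw [← Differential.logDeriv_algebraMap]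
    change δ (y : L) / (y : L) = _
    rw [hpq, Derivation.leibniz_div, hpoly, hpoly]
    simp only [smul_eq_mul]
    field_simp
  choose p q hp hq hpq using fun i => hrat (N i)
  have hinj : Function.Injective (aeval u : D.constants[X] →ₐ[D.constants] L) :=
    transcendental_iff_injective.mp hu'
  have hne : ∀ r : D.constants[X], r ≠ 0 → aeval u r ≠ 0 := fun r hr h0 =>
    hr (hinj (by rw [h0, map_zero]))
  refine Polynomial.const_mul_prod_ne_sum (ι := ι ⊕ ι) (C := D.constants) (d := d)
    (by exact_mod_cast hd) (Sum.elim c' (fun i => - c' i)) (Sum.elim p q)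
    (by rintro (i | i) <;> simp [hp, hq]) (hinj ?_)
  -- the nonzero constant `d` is a combination of logarithmic derivatives of polynomials in `u`,
  -- against the degree bound
  have key : (d : L) = ∑ i : ι ⊕ ι, algebraMap D.constants L (Sum.elim c' (fun i => - c' i) i) *
      (aeval u (derivative (Sum.elim p q i)) / aeval u (Sum.elim p q i)) := by
    have := congrArg (algebraMap K L) hN
    simp only [map_mul, _root_.map_natCast, mul_one, map_sum, hpq] at this
    rw [this, Fintype.sum_sum_type, ← Finset.sum_add_distrib]
    refine Finset.sum_congr rfl fun i _ => ?_
    rw [← IsScalarTower.algebraMap_apply]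
    simp only [Sum.elim_inl, Sum.elim_inr, map_neg]
    ring
  rw [map_mul, map_sum, aeval_C, _root_.map_natCast, key, Finset.sum_mul]
  refine Finset.sum_congr rfl fun i _ => ?_
  rw [map_mul, map_mul, aeval_C, map_prod, map_prod,
    ← Finset.mul_prod_erase Finset.univ _ (Finset.mem_univ i)]
  have : aeval u (Sum.elim p q i) ≠ 0 := hne _ (by rcases i with i | i <;> simp [hp, hq])
  field_simp

end derivations

section series

open PowerSeries

/-! ### Power series with algebraic coefficients -/

/-- A derivation of the coefficients acts coefficientwise on power series. -/
def PowerSeries.mapDerivation {k F : Type*} [Field k] [Field F] [Algebra k F] (D : Derivation k F F) :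
    Derivation k F⟦X⟧ F⟦X⟧ :=
  Derivation.mk'
    { toFun := fun p => PowerSeries.mk fun n => D (coeff n p)
      map_add' := fun p q => by ext n; simp
      map_smul' := fun a p => by ext n; simp }
    (fun p q => by
      ext n
      simp only [LinearMap.coe_mk, AddHom.coe_mk, coeff_mk, coeff_mul, map_sum, map_add, smul_eq_mul,
        Derivation.leibniz, Finset.sum_add_distrib]
      congr 1
      rw [← Finset.Nat.sum_antidiagonal_swap]
      rfl)

section mapDerivation

variable {k F : Type*} [Field k] [Field F] [Algebra k F] (D : Derivation k F F)

theorem PowerSeries.coeff_mapDerivation (p : F⟦X⟧) (n : ℕ) :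
    coeff n (mapDerivation D p) = D (coeff n p) := by
  simp [mapDerivation]

theorem PowerSeries.mapDerivation_derivative (p : F⟦X⟧) :
    mapDerivation D (d⁄dX F p) = d⁄dX F (mapDerivation D p) := by
  ext n
  have : D ((n : F) + 1) = 0 := by
    rw [map_add, D.map_natCast, D.map_one_eq_zero, add_zero]
  simp [coeff_mapDerivation, coeff_derivative, Derivation.leibniz, this, mul_comm]

theorem PowerSeries.mapDerivation_C (a : F) : mapDerivation D (C a) = C (D a) := by
  ext n
  rw [coeff_mapDerivation, coeff_C, coeff_C]
  split_ifs <;> simp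

theorem PowerSeries.mapDerivation_map (p : k⟦X⟧) : mapDerivation D (map (algebraMap k F) p) = 0 := by
  ext n
  simp [coeff_mapDerivation]

end mapDerivation

/-- The elements of a field that are algebraic over a subring. -/
def algebraicElements (k : Type*) {L : Type*} [Field k] [Field L] [Algebra k L] (R : Type*)
    [CommRing R] [IsDomain R] [Algebra R L]
    (h : ∀ r : k, ∃ a : R, algebraMap R L a = algebraMap k L r) : IntermediateField k L where
  carrier := {y | IsAlgebraic R y}
  mul_mem' ha hb := IsAlgebraic.mul ha hb
  add_mem' ha hb := IsAlgebraic.add ha hb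
  inv_mem' _ ha := IsAlgebraic.inv ha
  algebraMap_mem' r := by
    obtain ⟨a, ha⟩ := h r
    rw [← ha]
    exact isAlgebraic_algebraMap _

theorem mem_algebraicElements_of_isAlgebraic {k L R : Type*} [Field k] [Field L] [Algebra k L]
    [CommRing R] [IsDomain R] [Algebra R L]
    {h : ∀ r : k, ∃ a : R, algebraMap R L a = algebraMap k L r} {y : L}
    (hy : IsAlgebraic (algebraicElements k R h) y) : y ∈ algebraicElements k R h := by
  let _ : Algebra R (algebraicElements k R h) :=
    RingHom.toAlgebra ((algebraMap R L).codRestrict (algebraicElements k R h).toSubfield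
      fun r => isAlgebraic_algebraMap r)
  have : IsScalarTower R (algebraicElements k R h) L := IsScalarTower.of_algebraMap_eq fun _ => rfl
  have : Algebra.IsAlgebraic R (algebraicElements k R h) := ⟨fun z =>
    IsAlgebraic.of_ringHom_of_comp_eq (RingHom.id R) (algebraMap (algebraicElements k R h) L)
      z.2 Function.surjective_id (algebraMap (algebraicElements k R h) L).injective rfl⟩
  exact hy.restrictScalars R

section separated

variable (k F L : Type*) [Field k] [Field F] [Algebra k F] [Field L] [Algebra F⟦X⟧ L] [Algebra k L]
  [IsScalarTower k F⟦X⟧ L]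

/-- The embedding of the coefficient field as constant series. -/
def constSeries : F →ₐ[k] L where
  toRingHom := (algebraMap F⟦X⟧ L).comp (C (R := F))
  commutes' r := by
    rw [IsScalarTower.algebraMap_apply k F⟦X⟧ L]
    simp [PowerSeries.algebraMap_apply]

/-- The embedding of the series with coefficients in the ground field. -/
def scalarSeries : k⟦X⟧ →+* L :=
  (algebraMap F⟦X⟧ L).comp (map (algebraMap k F))

/-- The relative algebraic closure, in a field `L` containing `F⟦X⟧`, of the compositum of `F` and
`k⟦X⟧`: the series that are algebraic over the functions with separated variables. -/
def separatedClosure : IntermediateField k L :=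
  algebraicElements k (IntermediateField.adjoin k
    (Set.range (constSeries k F L) ∪ Set.range (scalarSeries k F L))) (fun r =>
      ⟨algebraMap k _ r, rfl⟩)

variable {k F L}

theorem constSeries_mem (a : F) : constSeries k F L a ∈ separatedClosure k F L :=
  isAlgebraic_algebraMap (⟨_, IntermediateField.subset_adjoin _ _ (Or.inl ⟨a, rfl⟩)⟩ :
    IntermediateField.adjoin k (Set.range (constSeries k F L) ∪ Set.range (scalarSeries k F L)))

theorem scalarSeries_mem (p : k⟦X⟧) : scalarSeries k F L p ∈ separatedClosure k F L :=
  isAlgebraic_algebraMap (⟨_, IntermediateField.subset_adjoin _ _ (Or.inr ⟨p, rfl⟩)⟩ :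
    IntermediateField.adjoin k (Set.range (constSeries k F L) ∪ Set.range (scalarSeries k F L)))

theorem mem_separatedClosure_of_isAlgebraic {y : L}
    (hy : IsAlgebraic (separatedClosure k F L) y) : y ∈ separatedClosure k F L :=
  mem_algebraicElements_of_isAlgebraic hy

theorem separatedClosure_le {K : IntermediateField k L}
    (h1 : ∀ a, constSeries k F L a ∈ K) (h2 : ∀ p, scalarSeries k F L p ∈ K)
    (hK : ∀ y, IsAlgebraic K y → y ∈ K) : separatedClosure k F L ≤ K := by
  intro y hy
  have hle : IntermediateField.adjoin k
      (Set.range (constSeries k F L) ∪ Set.range (scalarSeries k F L)) ≤ K := by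
    rw [IntermediateField.adjoin_le_iff]
    rintro _ (⟨a, rfl⟩ | ⟨p, rfl⟩)
    exacts [h1 a, h2 p]
  refine hK y ?_
  have hy : IsAlgebraic (IntermediateField.adjoin k
    (Set.range (constSeries k F L) ∪ Set.range (scalarSeries k F L))) y := hy
  exact hy.ringHom_of_comp_eq (IntermediateField.inclusion hle).toRingHom (RingHom.id _)
    (IntermediateField.inclusion hle).injective rfl

/-- The coefficientwise action of a derivation extends to a field of fractions. -/
theorem exists_derivation_fractionRing [IsFractionRing F⟦X⟧ L] (D : Derivation k F F) :
    ∃ D' : Derivation k L L,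
      ∀ q : F⟦X⟧, D' (algebraMap F⟦X⟧ L q) = algebraMap F⟦X⟧ L (mapDerivation D q) := by
  have : Algebra.FormallyEtale F⟦X⟧ L :=
    Algebra.FormallyEtale.of_isLocalization (nonZeroDivisors F⟦X⟧)
  exact exists_derivation_extension
    (((Algebra.linearMap F⟦X⟧ L).compDer (mapDerivation D) : Derivation k F⟦X⟧ L))

/-- If `Φ' = p + ∑ c i * (v i)' / v i` with scalar coefficients in `p` and a scalar `Φ(0)`, then a
derivation `D` of the coefficients makes `p` and `Φ(0)` disappear: the derivations `D` and `d/dX`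
commute, and so `DΦ` is the sum of the `c i * D(v i) / v i`, normalized to vanish at `X = 0`. -/
theorem derivation_eq_sum_of_derivative_eq (D : Derivation k F F) [CharZero F]
    {ι : Type*} [Fintype ι] (Φ : F⟦X⟧) (v : ι → F⟦X⟧)
    (c : ι → k) (hv0 : ∀ i, constantCoeff (v i) ≠ 0) {b : k}
    (hΦ0 : constantCoeff Φ = algebraMap k F b)
    {p : k⟦X⟧} (h : d⁄dX F Φ = map (algebraMap k F) p +
      ∑ i, C (algebraMap k F (c i)) * (d⁄dX F (v i) * (v i)⁻¹)) :
    mapDerivation D Φ = ∑ i, C (algebraMap k F (c i)) * (mapDerivation D (v i) * (v i)⁻¹ -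
      C (D (constantCoeff (v i)) * (constantCoeff (v i))⁻¹)) := by
  let D' := mapDerivation D
  have hvv : ∀ i, v i * (v i)⁻¹ = 1 := fun i => PowerSeries.mul_inv_cancel _ (hv0 i)
  have hmul : ∀ i, D' ((v i)⁻¹) = - (v i)⁻¹ ^ 2 * D' (v i) := fun i => by
    have := D'.leibniz_of_mul_eq_one (mul_comm (v i) _ ▸ hvv i)
    simpa using this
  have hswap : ∀ i, D' (d⁄dX F (v i) * (v i)⁻¹) = d⁄dX F (D' (v i) * (v i)⁻¹) := by
    intro i
    simp only [Derivation.leibniz, hmul, derivative_inv', smul_eq_mul, D', mapDerivation_derivative]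
    ring
  have hDC : ∀ a : k, D' (C (algebraMap k F a)) = 0 := fun a => by
    rw [mapDerivation_C, D.map_algebraMap, map_zero]
  apply PowerSeries.derivative.ext
  · rw [← mapDerivation_derivative, h]
    change D' _ = _
    rw [map_add, map_sum, map_sum, show D' (map (algebraMap k F) p) = 0 from mapDerivation_map D p,
      zero_add]
    refine Finset.sum_congr rfl fun i _ => ?_
    rw [D'.leibniz, hDC, hswap]
    simp [Derivation.leibniz, D']
  · have hc : ∀ q, constantCoeff (mapDerivation D q) = D (constantCoeff q) := fun q => by
      rw [← coeff_zero_eq_constantCoeff_apply, coeff_mapDerivation, coeff_zero_eq_constantCoeff_apply]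
    rw [hc, hΦ0, D.map_algebraMap]
    simp [hc]

theorem derivation_constSeries {D : Derivation k F F} {D' : Derivation k L L}
    (hD : ∀ q : F⟦X⟧, D' (algebraMap F⟦X⟧ L q) = algebraMap F⟦X⟧ L (mapDerivation D q)) (a : F) :
    D' (constSeries k F L a) = constSeries k F L (D a) := by
  change D' (algebraMap F⟦X⟧ L (C a)) = algebraMap F⟦X⟧ L (C (D a))
  rw [hD, mapDerivation_C]

/-- The series in `separatedClosure` are algebraic over the constants of `D'` and one more element `x`,
because `F` is algebraic over the constants and `x`, and series with scalar coefficients are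
constants. -/
theorem isAlgebraic_adjoin_of_mem_separatedClosure {D : Derivation k F F} {x : F}
    (hDx : ∀ K : IntermediateField k F, D.constants ≤ K → x ∈ K →
      (∀ y, IsAlgebraic K y → y ∈ K) → ∀ y, y ∈ K) {D' : Derivation k L L}
    (hD : ∀ q : F⟦X⟧, D' (algebraMap F⟦X⟧ L q) = algebraMap F⟦X⟧ L (mapDerivation D q)) {y : L}
    (hy : y ∈ separatedClosure k F L) :
    IsAlgebraic (Algebra.adjoin D'.constants {constSeries k F L x}) y := by
  let R := Algebra.adjoin D'.constants {constSeries k F L x}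
  let K : IntermediateField k L := algebraicElements k R
    (fun r => ⟨algebraMap D'.constants R (algebraMap k D'.constants r), rfl⟩)
  have hKcl : ∀ y, IsAlgebraic K y → y ∈ K := fun y => mem_algebraicElements_of_isAlgebraic
  have hconst : ∀ y, D' y = 0 → y ∈ K := fun y hy =>
    isAlgebraic_algebraMap (algebraMap D'.constants R ⟨y, hy⟩)
  have hxK : constSeries k F L x ∈ K :=
    isAlgebraic_algebraMap (⟨_, Algebra.subset_adjoin rfl⟩ : R)
  suffices separatedClosure k F L ≤ K from this hy
  refine separatedClosure_le ?_ ?_ hKcl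
  · refine hDx (K.comap (constSeries k F L)) ?_ hxK ?_
    · intro a ha
      exact hconst _ ((derivation_constSeries hD a).trans
        (by rw [D.mem_constants.mp ha, map_zero]))
    · intro y hy
      let g : K.comap (constSeries k F L) →+* K :=
        ((constSeries k F L : F →+* L).comp
          (algebraMap (K.comap (constSeries k F L)) F)).codRestrict K.toSubfield fun z => z.2
      exact hKcl _ (hy.ringHom_of_comp_eq g (constSeries k F L : F →+* L) g.injective rfl)
  · intro p
    refine hconst _ ?_
    change D' (algebraMap F⟦X⟧ L (map (algebraMap k F) p)) = 0
    rw [hD, mapDerivation_map, map_zero]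

/-- The algebraic heart of the argument. Suppose that `Φ` and the `v i` are algebraic over the functions
with separated variables, `Φ(0)` is a scalar, and `Φ' - ∑ c i * (v i)' / v i` has scalar coefficients.
Then the linear coefficient of `Φ` is algebraic over the ground field. Otherwise there is a derivation
`D` of the coefficients, nonzero at the linear coefficient, whose constants have corank one, and
`derivation_eq_sum_of_derivative_eq` together with the Ostrowski–Rosenlicht theorem gives
`DΦ = 0`. -/
theorem isAlgebraic_coeff_one [CharZero k] [IsFractionRing F⟦X⟧ L] {ι : Type*} [Fintype ι]
    (Φ : F⟦X⟧) (v : ι → F⟦X⟧)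
    (c : ι → k) (hv0 : ∀ i, constantCoeff (v i) ≠ 0) {b : k}
    (hΦ0 : constantCoeff Φ = algebraMap k F b)
    (hΦ : algebraMap F⟦X⟧ L Φ ∈ separatedClosure k F L)
    (hv : ∀ i, algebraMap F⟦X⟧ L (v i) ∈ separatedClosure k F L)
    {p : k⟦X⟧} (h : d⁄dX F Φ = map (algebraMap k F) p +
      ∑ i, C (algebraMap k F (c i)) * (d⁄dX F (v i) * (v i)⁻¹)) :
    IsAlgebraic k (coeff 1 Φ) := by
  by_contra hx
  have : CharZero F := charZero_of_injective_algebraMap (algebraMap k F).injective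
  have : CharZero L := charZero_of_injective_algebraMap (algebraMap k L).injective
  obtain ⟨D, hD1, hD⟩ := exists_derivation_of_transcendental hx
  have hinj : Function.Injective (algebraMap F⟦X⟧ L) := IsFractionRing.injective _ _
  obtain ⟨D', hD'⟩ := exists_derivation_fractionRing (L := L) D
  have hid := derivation_eq_sum_of_derivative_eq D Φ v c hv0 hΦ0 h
  have hzero : D' (algebraMap F⟦X⟧ L Φ) = 0 := by
    refine D'.eq_zero_of_eq_sum_logDeriv (ι := ι ⊕ ι) (constSeries k F L (coeff 1 Φ)) _
      (Sum.elim (fun i => algebraMap k L (c i)) (fun i => - algebraMap k L (c i)))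
      (Sum.elim (fun i => algebraMap F⟦X⟧ L (v i)) (fun i => constSeries k F L (constantCoeff (v i))))
      (isAlgebraic_adjoin_of_mem_separatedClosure hD hD' hΦ) ?_ ?_ ?_
    · rintro (i | i)
      exacts [isAlgebraic_adjoin_of_mem_separatedClosure hD hD' (hv i),
        isAlgebraic_adjoin_of_mem_separatedClosure hD hD' (constSeries_mem _)]
    · rintro (i | i) <;> simp
    · rw [hD', hid, Fintype.sum_sum_type, ← Finset.sum_add_distrib, map_sum]
      refine Finset.sum_congr rfl fun i _ => ?_
      have e1 : algebraMap F⟦X⟧ L (C (algebraMap k F (c i))) = algebraMap k L (c i) :=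
        (constSeries k F L).commutes _
      have e2 : algebraMap F⟦X⟧ L (v i)⁻¹ = (algebraMap F⟦X⟧ L (v i))⁻¹ :=
        eq_inv_of_mul_eq_one_left (by rw [← map_mul, PowerSeries.inv_mul_cancel _ (hv0 i), map_one])
      have e3 : ∀ a, algebraMap F⟦X⟧ L (C a) = constSeries k F L a := fun _ => rfl
      simp only [Sum.elim_inl, Sum.elim_inr, hD', derivation_constSeries hD', map_mul, map_sub, e1, e2,
        map_inv₀, e3]
      ring
  rw [hD'] at hzero
  have h0 : mapDerivation D Φ = 0 := hinj (by rw [hzero, map_zero])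
  have h1 := congrArg (coeff 1) h0
  rw [coeff_mapDerivation, hD1] at h1
  simp at h1

end separated

/-! ### Coefficients of algebraic power series -/

/-- The constant coefficients of an equation for `y` give an equation for the constant coefficient of
`y`, provided that not all of them vanish. -/
theorem isAlgebraic_constantCoeff_aux {R S : Type*} [CommRing R] [CommRing S] [Algebra R S]
    {y : S⟦X⟧} {Q : Polynomial R⟦X⟧} (hQ : Polynomial.aeval y Q = 0) {j : ℕ}
    (hj : constantCoeff (Q.coeff j) ≠ 0) : IsAlgebraic R (constantCoeff y) := by
  refine ⟨Q.map constantCoeff, fun h => hj ?_, ?_⟩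
  · simpa using congrArg (fun q => Polynomial.coeff q j) h
  · have := congrArg constantCoeff hQ
    rw [map_zero, Polynomial.aeval_def, Polynomial.hom_eval₂] at this
    rw [Polynomial.aeval_def, Polynomial.eval₂_map, ← this]
    congr 1

/-- If a power series is algebraic over the power series with coefficients in `R`, then its constant
coefficient is algebraic over `R`: an equation, divided by the largest possible power of `X`,
remains nontrivial for `X = 0`. -/
theorem isAlgebraic_constantCoeff {R S : Type*} [CommRing R] [CommRing S] [Algebra R S] {y : S⟦X⟧}
    (hy : IsAlgebraic R⟦X⟧ y) : IsAlgebraic R (constantCoeff y) := by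
  obtain ⟨Q, hQ0, hQ⟩ := hy
  obtain ⟨d, hd⟩ : ∃ d, Q.coeff d ≠ 0 := by
    by_contra! h
    exact hQ0 (Polynomial.ext (by simpa using h))
  obtain ⟨m, hm⟩ : ∃ m, coeff m (Q.coeff d) ≠ 0 := by
    by_contra! h
    exact hd (PowerSeries.ext (by simpa using h))
  clear hd hQ0
  -- induction on the order of vanishing of a nonzero coefficient, dividing by `X` when possible
  induction m generalizing Q with
  | zero => exact isAlgebraic_constantCoeff_aux hQ (by simpa using hm)
  | succ m ih =>
    by_cases hc : ∀ j, constantCoeff (Q.coeff j) = 0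
    · obtain ⟨Q', rfl⟩ : Polynomial.C X ∣ Q :=
        (Polynomial.C_dvd_iff_dvd_coeff _ _).mpr fun j => X_dvd_iff.mpr (hc j)
      refine ih Q' ?_ ?_
      · rw [map_mul, Polynomial.aeval_C, algebraMap_apply'', map_X] at hQ
        exact X_mul_cancel (by rw [hQ, mul_zero])
      · rwa [Polynomial.coeff_C_mul, coeff_succ_X_mul] at hm
    · push Not at hc
      obtain ⟨j, hj⟩ := hc
      exact isAlgebraic_constantCoeff_aux hQ hj

/-- A power series that is algebraic over series with coefficients in a relatively algebraically closed
subfield `K` has its coefficients in `K`. -/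
theorem coeff_mem_of_isAlgebraic {k L : Type*} [Field k] [Field L] [Algebra k L]
    {K : IntermediateField k L} (hK : ∀ y, IsAlgebraic K y → y ∈ K) {y : L⟦X⟧}
    (hy : IsAlgebraic K⟦X⟧ y) (n : ℕ) : coeff n y ∈ K := by
  induction n generalizing y with
  | zero => exact hK _ (by simpa using isAlgebraic_constantCoeff hy)
  | succ n ih =>
    have h0 : constantCoeff y ∈ K := hK _ (isAlgebraic_constantCoeff hy)
    obtain ⟨y', hy'⟩ : X ∣ y - C (constantCoeff y) := X_dvd_iff.mpr (by simp)
    have h1 : IsAlgebraic K⟦X⟧ (C (constantCoeff y)) := by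
      have := isAlgebraic_algebraMap (R := K⟦X⟧) (A := L⟦X⟧) (C ⟨_, h0⟩)
      rwa [algebraMap_apply'', map_C] at this
    have h2 : IsAlgebraic K⟦X⟧ (X : L⟦X⟧) := by
      have := isAlgebraic_algebraMap (R := K⟦X⟧) (A := L⟦X⟧) X
      rwa [algebraMap_apply'', map_X] at this
    have h3 : IsAlgebraic K⟦X⟧ y' := by
      refine IsAlgebraic.of_mul (y := X) (mem_nonZeroDivisors_of_ne_zero X_ne_zero) h2 ?_
      rw [← hy']
      exact hy.sub h1
    have := ih h3
    rw [← coeff_succ_X_mul, ← hy'] at this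
    simpa [coeff_C] using this

/-! ### Taylor expansion along a derivation -/

section taylor

variable {k A B : Type*} [Field k] [CommRing A] [CommRing B] [Algebra k A] [Algebra k B]

/-- The Taylor series of `a` along the derivation `D`, with coefficients transported by `ρ`. -/
def taylorSeries (D : Derivation k A A) (ρ : A →ₐ[k] B) (a : A) : B⟦X⟧ :=
  PowerSeries.mk fun n => ((n.factorial : k)⁻¹) • ρ (D^[n] a)

variable (D : Derivation k A A) (ρ : A →ₐ[k] B)

theorem coeff_taylorSeries (a : A) (n : ℕ) :
    coeff n (taylorSeries D ρ a) = ((n.factorial : k)⁻¹) • ρ (D^[n] a) := coeff_mk _ _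

theorem derivative_taylorSeries [CharZero k] (a : A) :
    d⁄dX B (taylorSeries D ρ a) = taylorSeries D ρ (D a) := by
  ext n
  rw [coeff_derivative, coeff_taylorSeries, coeff_taylorSeries, Function.iterate_succ_apply,
    Nat.factorial_succ]
  have : ((n : B) + 1) = algebraMap k B ((n : k) + 1) := by simp
  rw [this, mul_comm, ← Algebra.smul_def, smul_smul]
  congr 1
  have : (n : k) + 1 ≠ 0 := by exact_mod_cast n.succ_ne_zero
  have : (n.factorial : k) ≠ 0 := by exact_mod_cast n.factorial_ne_zero
  push_cast
  field_simp

theorem constantCoeff_taylorSeries (a : A) : constantCoeff (taylorSeries D ρ a) = ρ a := by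
  rw [← coeff_zero_eq_constantCoeff_apply, coeff_taylorSeries]
  simp

theorem taylorSeries_add (a b : A) :
    taylorSeries D ρ (a + b) = taylorSeries D ρ a + taylorSeries D ρ b := by
  ext n
  simp [coeff_taylorSeries, iterate_map_add]

theorem taylorSeries_mul [CharZero k] (a b : A) :
    taylorSeries D ρ (a * b) = taylorSeries D ρ a * taylorSeries D ρ b := by
  ext n
  induction n generalizing a b with
  | zero => simp [constantCoeff_taylorSeries]
  | succ n ih =>
    have h := derivative_taylorSeries D ρ (a * b)
    rw [D.leibniz, taylorSeries_add] at h
    have h2 := congrArg (coeff n) h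
    rw [coeff_derivative, map_add, smul_eq_mul, smul_eq_mul, ih, ih, ← map_add,
      ← derivative_taylorSeries, ← derivative_taylorSeries,
      ← smul_eq_mul (taylorSeries D ρ a), ← smul_eq_mul (taylorSeries D ρ b), ← Derivation.leibniz,
      coeff_derivative] at h2
    have h3 : IsUnit ((n : B) + 1) := by
      have : ((n : B) + 1) = algebraMap k B ((n : k) + 1) := by simp
      rw [this]
      exact (IsUnit.mk0 _ (by exact_mod_cast n.succ_ne_zero)).map _
    exact h3.mul_right_cancel h2

/-- Taylor expansion as a homomorphism of algebras. -/
def taylorHom [CharZero k] : A →ₐ[k] B⟦X⟧ :=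
  AlgHom.ofLinearMap
    { toFun := taylorSeries D ρ
      map_add' := taylorSeries_add D ρ
      map_smul' := fun c a => by
        have : ∀ n, D^[n] (c • a) = c • D^[n] a := fun n => by
          induction n with
          | zero => rfl
          | succ n ih => rw [Function.iterate_succ_apply', ih, D.map_smul,
              Function.iterate_succ_apply']
        ext n
        simp [coeff_taylorSeries, this, smul_comm c] }
    (by
      ext n
      change coeff n (taylorSeries D ρ 1) = _
      rw [coeff_taylorSeries, coeff_one]
      cases n with
      | zero => simp
      | succ n => simp [Function.iterate_succ_apply, iterate_map_zero])
    (taylorSeries_mul D ρ)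

end taylor

/-! ### Rings of germs of analytic functions -/

section germs

variable (V : Type*) [NormedAddCommGroup V] [NormedSpace ℂ V]

/-- The functions that are analytic at the origin. -/
def AnalyticFun : Subalgebra ℂ (V → ℂ) where
  carrier := {f | AnalyticAt ℂ f 0}
  mul_mem' ha hb := AnalyticAt.mul ha hb
  add_mem' ha hb := AnalyticAt.add ha hb
  algebraMap_mem' _ := analyticAt_const

/-- The ideal of functions vanishing near the origin. -/
def vanishingIdeal : Ideal (AnalyticFun V) where
  carrier := {f | ∀ᶠ x in 𝓝 (0 : V), (f : V → ℂ) x = 0}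
  add_mem' {a b} ha hb := by
    filter_upwards [ha, hb] with x h1 h2
    simp [h1, h2]
  zero_mem' := by simp
  smul_mem' c x hx := by
    filter_upwards [hx] with x h1
    simp [h1]

/-- The ring of germs at the origin of analytic functions on `V`. -/
def AnalyticGerm : Type _ := AnalyticFun V ⧸ vanishingIdeal V

instance : CommRing (AnalyticGerm V) := inferInstanceAs (CommRing (AnalyticFun V ⧸ vanishingIdeal V))

instance : Algebra ℂ (AnalyticGerm V) :=
  inferInstanceAs (Algebra ℂ (AnalyticFun V ⧸ vanishingIdeal V))

variable {V}

/-- The germ of a function that is analytic at the origin. -/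
def toGerm (f : V → ℂ) (hf : AnalyticAt ℂ f 0) : AnalyticGerm V :=
  Ideal.Quotient.mkₐ ℂ (vanishingIdeal V) ⟨f, hf⟩

theorem toGerm_eq_iff {f g : V → ℂ} {hf : AnalyticAt ℂ f 0} {hg : AnalyticAt ℂ g 0} :
    toGerm f hf = toGerm g hg ↔ f =ᶠ[𝓝 0] g := by
  refine (Ideal.Quotient.eq (I := vanishingIdeal V) (x := ⟨f, hf⟩) (y := ⟨g, hg⟩)).trans ?_
  change (∀ᶠ x in 𝓝 (0 : V), f x - g x = 0) ↔ _
  simp only [sub_eq_zero]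
  rfl

theorem exists_toGerm (x : AnalyticGerm V) :
    ∃ (f : V → ℂ) (hf : AnalyticAt ℂ f 0), toGerm f hf = x := by
  obtain ⟨f, rfl⟩ := Ideal.Quotient.mk_surjective x
  exact ⟨f.1, f.2, rfl⟩

theorem toGerm_add {f g : V → ℂ} (hf : AnalyticAt ℂ f 0) (hg : AnalyticAt ℂ g 0) :
    toGerm (fun x => f x + g x) (hf.add hg) = toGerm f hf + toGerm g hg := rfl

theorem toGerm_mul {f g : V → ℂ} (hf : AnalyticAt ℂ f 0) (hg : AnalyticAt ℂ g 0) :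
    toGerm (fun x => f x * g x) (hf.mul hg) = toGerm f hf * toGerm g hg := rfl

theorem toGerm_const (c : ℂ) :
    toGerm (fun _ : V => c) analyticAt_const = algebraMap ℂ (AnalyticGerm V) c := rfl

/-- Composition of germs with a linear map. -/
def pullback {W : Type*} [NormedAddCommGroup W] [NormedSpace ℂ W] (l : V →L[ℂ] W) :
    AnalyticGerm W →ₐ[ℂ] AnalyticGerm V :=
  Ideal.Quotient.liftₐ (vanishingIdeal W)
    ((Ideal.Quotient.mkₐ ℂ (vanishingIdeal V)).comp
      { toFun := fun f => ⟨fun x => f.1 (l x),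
          AnalyticAt.fun_comp (g := f.1) (by rw [map_zero]; exact f.2) (l.analyticAt 0)⟩
        map_one' := rfl
        map_mul' := fun _ _ => rfl
        map_zero' := rfl
        map_add' := fun _ _ => rfl
        commutes' := fun _ => rfl })
    (fun f hf => Ideal.Quotient.eq_zero_iff_mem.mpr
      ((show Filter.Tendsto l (𝓝 0) (𝓝 0) by simpa using l.continuous.tendsto 0).eventually hf))

theorem pullback_toGerm {W : Type*} [NormedAddCommGroup W] [NormedSpace ℂ W] (l : V →L[ℂ] W)
    {f : W → ℂ} (hf : AnalyticAt ℂ f 0) :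
    pullback l (toGerm f hf) = toGerm (fun x => f (l x))
      (AnalyticAt.fun_comp (by simpa using hf) (l.analyticAt 0)) := rfl

theorem AnalyticAt.fderiv_apply {f : V → ℂ} {x : V} (hf : AnalyticAt ℂ f x) (v : V) :
    AnalyticAt ℂ (fun x => fderiv ℂ f x v) x :=
  ((ContinuousLinearMap.apply ℂ ℂ v).analyticAt _).fun_comp hf.fderiv

/-- The function underlying `germDeriv`. -/
def germDerivFun (v : V) (x : AnalyticGerm V) : AnalyticGerm V :=
  toGerm (fun y => fderiv ℂ (exists_toGerm x).choose y v)
    ((exists_toGerm x).choose_spec.choose.fderiv_apply v)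

theorem germDerivFun_toGerm (v : V) {f : V → ℂ} (hf : AnalyticAt ℂ f 0) :
    germDerivFun v (toGerm f hf) = toGerm (fun y => fderiv ℂ f y v) (hf.fderiv_apply v) := by
  refine toGerm_eq_iff.mpr ?_
  have h := (toGerm_eq_iff.mp (exists_toGerm (toGerm f hf)).choose_spec.choose_spec).fderiv (𝕜 := ℂ)
  filter_upwards [h] with y hy
  rw [hy]

/-- Differentiation of germs in the direction `v`. -/
def germDeriv (v : V) : Derivation ℂ (AnalyticGerm V) (AnalyticGerm V) :=
  Derivation.mk'
    { toFun := germDerivFun v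
      map_add' := fun x y => by
        obtain ⟨f, hf, rfl⟩ := exists_toGerm x
        obtain ⟨g, hg, rfl⟩ := exists_toGerm y
        rw [← toGerm_add, germDerivFun_toGerm, germDerivFun_toGerm, germDerivFun_toGerm, ← toGerm_add]
        refine toGerm_eq_iff.mpr ?_
        filter_upwards [hf.eventually_analyticAt, hg.eventually_analyticAt] with y h1 h2
        rw [fderiv_fun_add h1.differentiableAt h2.differentiableAt]
        rfl
      map_smul' := fun c x => by
        obtain ⟨f, hf, rfl⟩ := exists_toGerm x
        rw [Algebra.smul_def, RingHom.id_apply, Algebra.smul_def c (germDerivFun v _),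
          ← toGerm_const, ← toGerm_mul,
          germDerivFun_toGerm, germDerivFun_toGerm, ← toGerm_mul]
        refine toGerm_eq_iff.mpr ?_
        filter_upwards [hf.eventually_analyticAt] with y h1
        rw [fderiv_const_mul h1.differentiableAt]
        rfl }
    (fun x y => by
      obtain ⟨f, hf, rfl⟩ := exists_toGerm x
      obtain ⟨g, hg, rfl⟩ := exists_toGerm y
      change germDerivFun v _ = toGerm f hf * germDerivFun v _ + toGerm g hg * germDerivFun v _
      rw [← toGerm_mul, germDerivFun_toGerm, germDerivFun_toGerm, germDerivFun_toGerm, ← toGerm_mul,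
        ← toGerm_mul, ← toGerm_add]
      refine toGerm_eq_iff.mpr ?_
      filter_upwards [hf.eventually_analyticAt, hg.eventually_analyticAt] with y h1 h2
      rw [fderiv_fun_mul h1.differentiableAt h2.differentiableAt]
      simp)

theorem germDeriv_toGerm (v : V) {f : V → ℂ} (hf : AnalyticAt ℂ f 0) :
    germDeriv v (toGerm f hf) = toGerm (fun y => fderiv ℂ f y v) (hf.fderiv_apply v) :=
  germDerivFun_toGerm v hf

/-- The Taylor expansion of germs on `V × ℂ` in powers of the last variable. -/
def germTaylor (V : Type*) [NormedAddCommGroup V] [NormedSpace ℂ V] :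
    AnalyticGerm (V × ℂ) →ₐ[ℂ] (AnalyticGerm V)⟦X⟧ :=
  taylorHom (germDeriv ((0 : V), (1 : ℂ))) (pullback (ContinuousLinearMap.inl ℂ V ℂ))

theorem germTaylor_apply (x : AnalyticGerm (V × ℂ)) : germTaylor V x =
    taylorSeries (germDeriv ((0 : V), (1 : ℂ))) (pullback (ContinuousLinearMap.inl ℂ V ℂ)) x := rfl

theorem coeff_germTaylor (x : AnalyticGerm (V × ℂ)) (n : ℕ) :
    coeff n (germTaylor V x) = ((n.factorial : ℂ)⁻¹) •
      pullback (ContinuousLinearMap.inl ℂ V ℂ) ((germDeriv ((0 : V), (1 : ℂ)))^[n] x) := by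
  rw [germTaylor_apply, coeff_taylorSeries]

theorem derivative_germTaylor (x : AnalyticGerm (V × ℂ)) :
    d⁄dX _ (germTaylor V x) = germTaylor V (germDeriv ((0 : V), (1 : ℂ)) x) := by
  rw [germTaylor_apply, derivative_taylorSeries, germTaylor_apply]

theorem constantCoeff_germTaylor (x : AnalyticGerm (V × ℂ)) :
    constantCoeff (germTaylor V x) = pullback (ContinuousLinearMap.inl ℂ V ℂ) x := by
  rw [germTaylor_apply, constantCoeff_taylorSeries]

theorem pullback_pullback {W U : Type*} [NormedAddCommGroup W] [NormedSpace ℂ W]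
    [NormedAddCommGroup U] [NormedSpace ℂ U] (l : V →L[ℂ] W) (l' : W →L[ℂ] U) (x : AnalyticGerm U) :
    pullback l (pullback l' x) = pullback (l'.comp l) x := by
  obtain ⟨f, hf, rfl⟩ := exists_toGerm x
  rfl

theorem germDeriv_pullback {W : Type*} [NormedAddCommGroup W] [NormedSpace ℂ W] (l : V →L[ℂ] W)
    (v : V) (x : AnalyticGerm W) :
    germDeriv v (pullback l x) = pullback l (germDeriv (l v) x) := by
  obtain ⟨f, hf, rfl⟩ := exists_toGerm x
  rw [pullback_toGerm, germDeriv_toGerm, germDeriv_toGerm, pullback_toGerm]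
  refine toGerm_eq_iff.mpr ?_
  have : ∀ᶠ y in 𝓝 (0 : V), AnalyticAt ℂ f (l y) :=
    (show Filter.Tendsto l (𝓝 0) (𝓝 0) by simpa using l.continuous.tendsto 0).eventually
      hf.eventually_analyticAt
  filter_upwards [this] with y hy
  rw [fderiv_fun_comp y hy.differentiableAt l.differentiableAt]
  simp

/-- Taylor expansion is natural in the parameter space. -/
theorem germTaylor_pullback {W : Type*} [NormedAddCommGroup W] [NormedSpace ℂ W] (l : V →L[ℂ] W)
    (x : AnalyticGerm (W × ℂ)) :
    germTaylor V (pullback (l.prodMap (ContinuousLinearMap.id ℂ ℂ)) x) =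
      map (pullback l : AnalyticGerm W →+* AnalyticGerm V) (germTaylor W x) := by
  ext n
  rw [coeff_map, coeff_germTaylor, coeff_germTaylor]
  have : ∀ n, (germDeriv ((0 : V), (1 : ℂ)))^[n]
      (pullback (l.prodMap (ContinuousLinearMap.id ℂ ℂ)) x) =
      pullback (l.prodMap (ContinuousLinearMap.id ℂ ℂ)) ((germDeriv ((0 : W), (1 : ℂ)))^[n] x) := by
    intro n
    induction n with
    | zero => rfl
    | succ n ih =>
      rw [Function.iterate_succ_apply', ih, germDeriv_pullback, Function.iterate_succ_apply']
      simp
  rw [this, pullback_pullback]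
  change _ = (pullback l) _
  rw [map_smul, pullback_pullback]
  congr 2

theorem germTaylor_pullback_fst (x : AnalyticGerm V) :
    germTaylor V (pullback (ContinuousLinearMap.fst ℂ V ℂ) x) = C x := by
  ext n
  rw [coeff_germTaylor, coeff_C]
  cases n with
  | zero =>
    rw [Function.iterate_zero_apply, pullback_pullback]
    obtain ⟨f, hf, rfl⟩ := exists_toGerm x
    simp [pullback_toGerm]
  | succ n =>
    rw [Function.iterate_succ_apply, germDeriv_pullback]
    have : ∀ x : AnalyticGerm V, germDeriv (0 : V) x = 0 := fun x => by
      obtain ⟨f, hf, rfl⟩ := exists_toGerm x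
      rw [germDeriv_toGerm]
      simp only [map_zero]
      exact (toGerm_const 0).trans (map_zero _)
    simp [this, iterate_map_zero]

end germs

instance : IsDomain (AnalyticGerm ℂ) := by
  have : (vanishingIdeal ℂ).IsPrime := by
    refine ⟨fun h => ?_, fun {f g} hfg => ?_⟩
    · have h1 : (1 : AnalyticFun ℂ) ∈ vanishingIdeal ℂ := by rw [h]; trivial
      have h2 : ∀ᶠ x in 𝓝 (0 : ℂ), (1 : ℂ) = 0 := h1
      simpa using h2.self_of_nhds
    · by_contra! hne
      have hf : ∀ᶠ x in 𝓝[≠] (0 : ℂ), f.1 x ≠ 0 :=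
        (f.2.eventually_eq_zero_or_eventually_ne_zero).resolve_left hne.1
      have hg : ∀ᶠ x in 𝓝[≠] (0 : ℂ), g.1 x ≠ 0 :=
        (g.2.eventually_eq_zero_or_eventually_ne_zero).resolve_left hne.2
      have hfg' : ∀ᶠ x in 𝓝[≠] (0 : ℂ), f.1 x * g.1 x = 0 := nhdsWithin_le_nhds hfg
      obtain ⟨x, h1, h2, h3⟩ := (hf.and (hg.and hfg')).exists
      exact mul_ne_zero h1 h2 h3
  exact inferInstanceAs (IsDomain (AnalyticFun ℂ ⧸ vanishingIdeal ℂ))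

/-! ### Algebraicity of Nash functions of germs -/

section nash

variable {V : Type*} [NormedAddCommGroup V] [NormedSpace ℂ V]

theorem toGerm_congr {f g : V → ℂ} (hf : AnalyticAt ℂ f 0) (h : f = g) :
    toGerm f hf = toGerm g (h ▸ hf) := by
  subst h; rfl

/-- A polynomial equation between functions gives one between their germs. -/
theorem eval₂_toGerm_eq_zero {σ : Type*} {x : σ → V → ℂ} (hx : ∀ i, AnalyticAt ℂ (x i) 0)
    {H : V → ℂ} (hH : AnalyticAt ℂ H 0) (P : Polynomial (MvPolynomial σ ℂ))
    (h : ∀ᶠ v in 𝓝 0, P.eval₂ (MvPolynomial.eval fun i => x i v) (H v) = 0) :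
    P.eval₂ (MvPolynomial.aeval fun i => toGerm (x i) (hx i)).toRingHom (toGerm H hH) = 0 := by
  let x' : σ → AnalyticFun V := fun i => ⟨x i, hx i⟩
  let H' : AnalyticFun V := ⟨H, hH⟩
  let q : AnalyticFun V →ₐ[ℂ] AnalyticGerm V := Ideal.Quotient.mkₐ ℂ (vanishingIdeal V)
  have h1 : P.eval₂ (MvPolynomial.aeval fun i => toGerm (x i) (hx i)).toRingHom (toGerm H hH) =
      q (P.eval₂ (MvPolynomial.aeval x').toRingHom H') := by
    rw [← AlgHom.coe_toRingHom, Polynomial.hom_eval₂]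
    congr 1
    refine MvPolynomial.ringHom_ext (fun r => ?_) (fun i => ?_)
    · change MvPolynomial.aeval _ (MvPolynomial.C r) = q (MvPolynomial.aeval x' (MvPolynomial.C r))
      rw [MvPolynomial.aeval_C, MvPolynomial.aeval_C, q.commutes]
    · change MvPolynomial.aeval _ (MvPolynomial.X i) = q (MvPolynomial.aeval x' (MvPolynomial.X i))
      rw [MvPolynomial.aeval_X, MvPolynomial.aeval_X]
      rfl
  rw [h1]
  refine Ideal.Quotient.eq_zero_iff_mem.mpr ?_
  change ∀ᶠ v in 𝓝 0, _
  filter_upwards [h] with v hv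
  let ev : AnalyticFun V →ₐ[ℂ] ℂ := (Pi.evalAlgHom ℂ _ v).comp (AnalyticFun V).val
  change ev _ = 0
  rw [← AlgHom.coe_toRingHom, Polynomial.hom_eval₂, ← hv]
  congr 1
  ext i <;> simp [ev, x']

/-- The last coordinate is the variable of the Taylor expansion. -/
theorem germTaylor_snd : germTaylor V (toGerm (fun p : V × ℂ => p.2) analyticAt_snd) = X := by
  have h1 : germDeriv ((0 : V), (1 : ℂ)) (toGerm (fun p : V × ℂ => p.2) analyticAt_snd) = 1 := by
    rw [germDeriv_toGerm, ← map_one (algebraMap ℂ (AnalyticGerm (V × ℂ))), ← toGerm_const]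
    refine toGerm_congr _ ?_
    funext p
    simp [fderiv_snd]
  ext n
  rw [coeff_germTaylor, coeff_X]
  match n with
  | 0 =>
    rw [Function.iterate_zero_apply, pullback_toGerm]
    simp only [ContinuousLinearMap.inl_apply, toGerm_const]
    simp
  | 1 => simp [h1]
  | n + 2 => simp [Function.iterate_succ_apply, h1, iterate_map_zero]

/-- A Nash function of functions `x i` whose images under `θ` lie in the domain `R` is algebraic over
`R`. The polynomial equation of `G` may degenerate along `x`; it does not along the homotopy
`(1 - η) x + η c` to a suitable constant `c`, whose constant coefficient in `η` is the function in
question. -/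
theorem isAlgebraic_nash {R Λ σ : Type*} [Fintype σ] [CommRing R] [IsDomain R] [CommRing Λ]
    [Algebra R Λ] [Algebra ℂ R] [Algebra ℂ Λ] [IsScalarTower ℂ R Λ] (θ : AnalyticGerm V →ₐ[ℂ] Λ)
    {x : σ → V → ℂ} (hx : ∀ i, AnalyticAt ℂ (x i) 0)
    (hxR : ∀ i, θ (toGerm (x i) (hx i)) ∈ Set.range (algebraMap R Λ))
    {G : (σ → ℂ) → ℂ} (hG : AnalyticAt ℂ G (fun i => x i 0))
    {P : Polynomial (MvPolynomial σ ℂ)} (hP : P ≠ 0)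
    (hPG : ∀ᶠ y in 𝓝 (fun i => x i 0), P.eval₂ (MvPolynomial.eval y) (G y) = 0)
    (hGx : AnalyticAt ℂ (fun v => G (fun i => x i v)) 0) :
    IsAlgebraic R (θ (toGerm (fun v => G (fun i => x i v)) hGx)) := by
  choose r hr using hxR
  obtain ⟨d, hd⟩ : ∃ d, P.coeff d ≠ 0 := by
    by_contra! h
    exact hP (Polynomial.ext (by simpa using h))
  obtain ⟨c, hc⟩ : ∃ c : σ → ℂ, MvPolynomial.eval c (P.coeff d) ≠ 0 := by
    by_contra! h
    exact hd (MvPolynomial.funext (by simpa using h))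
  -- the homotopy from `x` to the constant `c`
  let y : σ → V × ℂ → ℂ := fun i p => (1 - p.2) * x i p.1 + p.2 * c i
  have hx' : ∀ i, AnalyticAt ℂ (fun p : V × ℂ => x i p.1) 0 := fun i =>
    AnalyticAt.fun_comp (g := x i) (hx i) analyticAt_fst
  have hy : ∀ i, AnalyticAt ℂ (y i) 0 := fun i =>
    ((analyticAt_const.sub analyticAt_snd).mul (hx' i)).add (analyticAt_snd.mul analyticAt_const)
  have hy0 : (fun i => y i 0) = fun i => x i 0 := by
    funext i; simp [y]
  have hyv : AnalyticAt ℂ (fun p => fun i => y i p) 0 := AnalyticAt.pi hy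
  let H : V × ℂ → ℂ := fun p => G (fun i => y i p)
  have hH : AnalyticAt ℂ H 0 := AnalyticAt.fun_comp (g := G) (by rw [hy0]; exact hG) hyv
  have hrel : ∀ᶠ p in 𝓝 0, P.eval₂ (MvPolynomial.eval fun i => y i p) (H p) = 0 := by
    have : Filter.Tendsto (fun p => fun i => y i p) (𝓝 0) (𝓝 (fun i => x i 0)) := by
      rw [← hy0]; exact hyv.continuousAt
    exact this.eventually hPG
  have key := eval₂_toGerm_eq_zero hy hH P hrel
  let Θ : AnalyticGerm (V × ℂ) →ₐ[ℂ] Λ⟦X⟧ := (mapAlgHom θ).comp (germTaylor V)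
  let s : σ → Polynomial R := fun i => (1 - Polynomial.X) * Polynomial.C (r i) +
    Polynomial.X * Polynomial.C (algebraMap ℂ R (c i))
  have hs : ∀ i, Θ (toGerm (y i) (hy i)) = algebraMap R⟦X⟧ Λ⟦X⟧ (s i : R⟦X⟧) := by
    intro i
    have e1 : toGerm (y i) (hy i) =
        (1 - toGerm (fun p => p.2) analyticAt_snd) *
          pullback (ContinuousLinearMap.fst ℂ V ℂ) (toGerm (x i) (hx i)) +
        toGerm (fun p => p.2) analyticAt_snd * algebraMap ℂ _ (c i) := rfl
    have e2 : germTaylor V (toGerm (fun p : V × ℂ => p.2) analyticAt_snd) = X :=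
      germTaylor_snd
    have e3 : Θ (algebraMap ℂ _ (c i)) = C (algebraMap ℂ Λ (c i)) := by
      rw [Θ.commutes, PowerSeries.algebraMap_apply]
    have e4 : Θ (toGerm (fun p : V × ℂ => p.2) analyticAt_snd) = X := by
      change mapAlgHom θ (germTaylor V _) = _
      rw [e2, mapAlgHom_apply, map_X]
    have e5 : Θ (pullback (ContinuousLinearMap.fst ℂ V ℂ) (toGerm (x i) (hx i))) =
        C (algebraMap R Λ (r i)) := by
      change mapAlgHom θ (germTaylor V _) = _
      rw [germTaylor_pullback_fst, mapAlgHom_apply, map_C, hr]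
      rfl
    rw [e1, map_add, map_mul, map_mul, map_sub, map_one, e3, e4, e5, algebraMap_apply'']
    simp only [s, Polynomial.coe_add, Polynomial.coe_mul, Polynomial.coe_sub, Polynomial.coe_one,
      Polynomial.coe_X, Polynomial.coe_C, map_add, map_mul, map_sub, map_one, map_X, map_C,
      IsScalarTower.algebraMap_apply ℂ R Λ]
  let Q : Polynomial R⟦X⟧ :=
    P.map (((Polynomial.coeToPowerSeries.ringHom (R := R)).comp (MvPolynomial.aeval s).toRingHom))
  have hQ : Q ≠ 0 := by
    intro h
    have h1 := congrArg (fun q => Polynomial.coeff q d) h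
    simp only [Q, Polynomial.coeff_map, Polynomial.coeff_zero, RingHom.comp_apply] at h1
    have h2 : MvPolynomial.aeval s (P.coeff d) = 0 :=
      Polynomial.coe_injective R (by rw [Polynomial.coe_zero]; exact h1)
    have h3 := congrArg (Polynomial.eval (1 : R)) h2
    have h4 : Polynomial.eval (1 : R) (MvPolynomial.aeval s (P.coeff d)) =
        algebraMap ℂ R (MvPolynomial.eval c (P.coeff d)) := by
      have : (Polynomial.evalRingHom (1 : R)).comp (MvPolynomial.aeval s).toRingHom =
          (algebraMap ℂ R).comp (MvPolynomial.eval c) := by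
        refine MvPolynomial.ringHom_ext (fun r => ?_) (fun i => ?_)
        · change Polynomial.eval (1 : R) (MvPolynomial.aeval s (MvPolynomial.C r)) = _
          simp [Polynomial.algebraMap_apply]
        · change Polynomial.eval (1 : R) (MvPolynomial.aeval s (MvPolynomial.X i)) = _
          simp [s]
      exact congrArg (fun f => f (P.coeff d)) this
    rw [h4, Polynomial.eval_zero] at h3
    exact hc ((algebraMap ℂ R).injective (by rw [h3, map_zero]))
  have hroot : Polynomial.aeval (Θ (toGerm H hH)) Q = 0 := by
    have := congrArg Θ key
    rw [← AlgHom.coe_toRingHom, Polynomial.hom_eval₂, map_zero] at this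
    rw [Polynomial.aeval_def, Polynomial.eval₂_map, ← this]
    congr 1
    refine MvPolynomial.ringHom_ext (fun r => ?_) (fun i => ?_)
    · change algebraMap R⟦X⟧ Λ⟦X⟧ ((MvPolynomial.aeval s (MvPolynomial.C r) : Polynomial R) : R⟦X⟧) =
        Θ (MvPolynomial.aeval _ (MvPolynomial.C r))
      rw [MvPolynomial.aeval_C, MvPolynomial.aeval_C, Θ.commutes, Polynomial.algebraMap_apply,
        Polynomial.coe_C, algebraMap_apply'', map_C, ← IsScalarTower.algebraMap_apply,
        PowerSeries.algebraMap_apply]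
    · change algebraMap R⟦X⟧ Λ⟦X⟧ ((MvPolynomial.aeval s (MvPolynomial.X i) : Polynomial R) : R⟦X⟧) =
        Θ (MvPolynomial.aeval _ (MvPolynomial.X i))
      rw [MvPolynomial.aeval_X, MvPolynomial.aeval_X, hs]
  have halg := isAlgebraic_constantCoeff ⟨Q, hQ, hroot⟩
  have h0 : constantCoeff (Θ (toGerm H hH)) = θ (toGerm (fun v => G (fun i => x i v)) hGx) := by
    change constantCoeff (mapAlgHom θ (germTaylor V _)) = _
    rw [mapAlgHom_apply, ← coeff_zero_eq_constantCoeff_apply, coeff_map,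
      coeff_zero_eq_constantCoeff_apply, constantCoeff_germTaylor, pullback_toGerm]
    change θ _ = θ _
    congr 1
    exact toGerm_congr _ (by funext v; simp [H, y])
  rwa [h0] at halg

end nash

/-! ### Germs that are algebraic over the functions with separated variables -/

/-- The field of germs of meromorphic functions of one variable. -/
def MeroGerm : Type := FractionRing (AnalyticGerm ℂ)

instance : Field MeroGerm := inferInstanceAs (Field (FractionRing (AnalyticGerm ℂ)))

instance : Algebra ℂ MeroGerm := inferInstanceAs (Algebra ℂ (FractionRing (AnalyticGerm ℂ)))

/-- The embedding of analytic germs into meromorphic germs. -/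
def meroOfGerm : AnalyticGerm ℂ →ₐ[ℂ] MeroGerm :=
  IsScalarTower.toAlgHom ℂ (AnalyticGerm ℂ) (FractionRing (AnalyticGerm ℂ))

theorem meroOfGerm_injective : Function.Injective meroOfGerm :=
  IsFractionRing.injective (AnalyticGerm ℂ) (FractionRing (AnalyticGerm ℂ))

/-- The field of fractions of the ring of power series over `MeroGerm`. -/
def MeroSeries : Type := FractionRing MeroGerm⟦X⟧

instance : Field MeroSeries := inferInstanceAs (Field (FractionRing MeroGerm⟦X⟧))

instance : Algebra MeroGerm⟦X⟧ MeroSeries :=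
  inferInstanceAs (Algebra MeroGerm⟦X⟧ (FractionRing MeroGerm⟦X⟧))

instance : IsFractionRing MeroGerm⟦X⟧ MeroSeries :=
  inferInstanceAs (IsFractionRing MeroGerm⟦X⟧ (FractionRing MeroGerm⟦X⟧))

instance : Algebra ℂ MeroSeries := inferInstanceAs (Algebra ℂ (FractionRing MeroGerm⟦X⟧))

instance : IsScalarTower ℂ MeroGerm⟦X⟧ MeroSeries :=
  inferInstanceAs (IsScalarTower ℂ MeroGerm⟦X⟧ (FractionRing MeroGerm⟦X⟧))

/-- The expansion of a germ in two variables `(t, s)` in powers of `s`, with coefficients the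
meromorphic germs in `t`. -/
def expandGerm : AnalyticGerm (ℂ × ℂ) →ₐ[ℂ] MeroGerm⟦X⟧ :=
  (mapAlgHom meroOfGerm).comp (germTaylor ℂ)

theorem expandGerm_apply (x : AnalyticGerm (ℂ × ℂ)) :
    expandGerm x = map (meroOfGerm : AnalyticGerm ℂ →+* MeroGerm) (germTaylor ℂ x) := by
  change mapAlgHom meroOfGerm (germTaylor ℂ x) = _
  rw [mapAlgHom_apply]

/-- `expandGerm`, followed by the inclusion into the field of fractions. -/
def expandGermField : AnalyticGerm (ℂ × ℂ) →ₐ[ℂ] MeroSeries :=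
  (IsScalarTower.toAlgHom ℂ MeroGerm⟦X⟧ MeroSeries).comp expandGerm

theorem expandGermField_apply (x : AnalyticGerm (ℂ × ℂ)) :
    expandGermField x = algebraMap MeroGerm⟦X⟧ MeroSeries (expandGerm x) := rfl

/-- The function `g(t, s)` is analytic at the origin, and algebraic over the field generated by the
germs of functions of `t` alone and the functions of `s` alone. -/
def IsSepAlgebraic (g : ℂ × ℂ → ℂ) : Prop :=
  ∃ hg : AnalyticAt ℂ g 0, expandGermField (toGerm g hg) ∈ separatedClosure ℂ MeroGerm MeroSeries

theorem expandGermField_fst_mem (x : AnalyticGerm ℂ) :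
    expandGermField (pullback (ContinuousLinearMap.fst ℂ ℂ ℂ) x) ∈
      separatedClosure ℂ MeroGerm MeroSeries := by
  rw [expandGermField_apply, expandGerm_apply, germTaylor_pullback_fst, map_C]
  exact constSeries_mem (L := MeroSeries) _

theorem germTaylor_pullback_snd (x : AnalyticGerm ℂ) :
    ∃ p : ℂ⟦X⟧, germTaylor ℂ (pullback (ContinuousLinearMap.snd ℂ ℂ ℂ) x) =
      map (algebraMap ℂ (AnalyticGerm ℂ)) p := by
  have h : pullback (ContinuousLinearMap.snd ℂ ℂ ℂ) x =
      pullback ((0 : ℂ →L[ℂ] ℂ).prodMap (ContinuousLinearMap.id ℂ ℂ))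
        (pullback (ContinuousLinearMap.snd ℂ ℂ ℂ) x) := by
    rw [pullback_pullback]
    congr 1
  rw [h, germTaylor_pullback]
  have h0 : ∀ y : AnalyticGerm ℂ, ∃ c : ℂ, pullback (0 : ℂ →L[ℂ] ℂ) y = algebraMap ℂ _ c := by
    intro y
    obtain ⟨f, hf, rfl⟩ := exists_toGerm y
    exact ⟨f 0, rfl⟩
  choose c hc using h0
  refine ⟨PowerSeries.mk fun n =>
    c (coeff n (germTaylor ℂ (pullback (ContinuousLinearMap.snd ℂ ℂ ℂ) x))), ?_⟩
  ext n
  rw [coeff_map, coeff_map, coeff_mk]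
  exact hc _

/-- A function of `s` alone expands into a series with scalar coefficients. -/
theorem expandGerm_snd (x : AnalyticGerm ℂ) :
    ∃ p : ℂ⟦X⟧, expandGerm (pullback (ContinuousLinearMap.snd ℂ ℂ ℂ) x) =
      map (algebraMap ℂ MeroGerm) p := by
  obtain ⟨p, hp⟩ := germTaylor_pullback_snd x
  refine ⟨p, ?_⟩
  rw [expandGerm_apply, hp]
  ext n
  simp only [coeff_map]
  exact meroOfGerm.commutes _

theorem expandGermField_snd_mem (x : AnalyticGerm ℂ) :
    expandGermField (pullback (ContinuousLinearMap.snd ℂ ℂ ℂ) x) ∈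
      separatedClosure ℂ MeroGerm MeroSeries := by
  obtain ⟨p, hp⟩ := expandGerm_snd x
  rw [expandGermField_apply, hp]
  exact scalarSeries_mem (L := MeroSeries) p

namespace IsSepAlgebraic

theorem analyticAt {g : ℂ × ℂ → ℂ} (h : IsSepAlgebraic g) : AnalyticAt ℂ g 0 := h.1

theorem add {f g : ℂ × ℂ → ℂ} (hf : IsSepAlgebraic f) (hg : IsSepAlgebraic g) :
    IsSepAlgebraic (fun x => f x + g x) :=
  ⟨hf.1.add hg.1, by rw [toGerm_add hf.1 hg.1, map_add]; exact add_mem hf.2 hg.2⟩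

theorem mul {f g : ℂ × ℂ → ℂ} (hf : IsSepAlgebraic f) (hg : IsSepAlgebraic g) :
    IsSepAlgebraic (fun x => f x * g x) :=
  ⟨hf.1.mul hg.1, by rw [toGerm_mul hf.1 hg.1, map_mul]; exact mul_mem hf.2 hg.2⟩

theorem const (c : ℂ) : IsSepAlgebraic (fun _ => c) :=
  ⟨analyticAt_const, by
    rw [toGerm_const, AlgHom.commutes]
    exact IntermediateField.algebraMap_mem _ c⟩

theorem congr {f g : ℂ × ℂ → ℂ} (hf : IsSepAlgebraic f) (h : f =ᶠ[𝓝 0] g) : IsSepAlgebraic g := by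
  refine ⟨hf.1.congr h, ?_⟩
  have : toGerm g (hf.1.congr h) = toGerm f hf.1 := toGerm_eq_iff.mpr h.symm
  rw [this]
  exact hf.2

theorem inv {f : ℂ × ℂ → ℂ} (hf : IsSepAlgebraic f) (h0 : f 0 ≠ 0) :
    IsSepAlgebraic (fun x => (f x)⁻¹) := by
  refine ⟨hf.1.inv h0, ?_⟩
  have h1 : toGerm f hf.1 * toGerm (fun x => (f x)⁻¹) (hf.1.inv h0) = 1 := by
    rw [← toGerm_mul, ← map_one (algebraMap ℂ _), ← toGerm_const]
    refine toGerm_eq_iff.mpr ?_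
    filter_upwards [hf.1.continuousAt.eventually_ne h0] with x hx
    exact mul_inv_cancel₀ hx
  have h2 := congrArg expandGermField h1
  rw [map_mul, map_one] at h2
  rw [eq_inv_of_mul_eq_one_right h2]
  exact inv_mem hf.2

theorem sum {ι : Type*} (s : Finset ι) {f : ι → ℂ × ℂ → ℂ} (hf : ∀ i ∈ s, IsSepAlgebraic (f i)) :
    IsSepAlgebraic (fun x => ∑ i ∈ s, f i x) := by
  classical
  induction s using Finset.induction_on with
  | empty => simpa using const 0
  | insert a s ha ih =>
    simp only [Finset.sum_insert ha]
    exact (hf _ (Finset.mem_insert_self _ _)).add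
      (ih fun i hi => hf i (Finset.mem_insert_of_mem hi))

theorem prod {ι : Type*} (s : Finset ι) {f : ι → ℂ × ℂ → ℂ} (hf : ∀ i ∈ s, IsSepAlgebraic (f i)) :
    IsSepAlgebraic (fun x => ∏ i ∈ s, f i x) := by
  classical
  induction s using Finset.induction_on with
  | empty => simpa using const 1
  | insert a s ha ih =>
    simp only [Finset.prod_insert ha]
    exact (hf _ (Finset.mem_insert_self _ _)).mul
      (ih fun i hi => hf i (Finset.mem_insert_of_mem hi))

theorem det {m : ℕ} {f : Fin m → Fin m → ℂ × ℂ → ℂ} (hf : ∀ i j, IsSepAlgebraic (f i j)) :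
    IsSepAlgebraic (fun x => (Matrix.of fun i j => f i j x).det) := by
  simp only [Matrix.det_apply', Matrix.of_apply]
  exact sum _ fun σ _ => (const _).mul (prod _ fun i _ => hf _ _)

end IsSepAlgebraic

/-- The expansion in powers of `ε` of germs in `((t, s), ε)`. -/
def expandGermParam : AnalyticGerm ((ℂ × ℂ) × ℂ) →ₐ[ℂ] MeroSeries⟦X⟧ :=
  (mapAlgHom expandGermField).comp (germTaylor (ℂ × ℂ))

theorem expandGermParam_apply (x : AnalyticGerm ((ℂ × ℂ) × ℂ)) :
    expandGermParam x = map (expandGermField : AnalyticGerm (ℂ × ℂ) →+* MeroSeries)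
      (germTaylor (ℂ × ℂ) x) := by
  change mapAlgHom expandGermField (germTaylor (ℂ × ℂ) x) = _
  rw [mapAlgHom_apply]

theorem expandGermParam_mem_range {x : AnalyticGerm ((ℂ × ℂ) × ℂ)} (l : ℂ × ℂ →L[ℂ] ℂ)
    (hl : ∀ y, expandGermField (pullback l y) ∈ separatedClosure ℂ MeroGerm MeroSeries)
    {y : AnalyticGerm (ℂ × ℂ)} (hx : x = pullback (l.prodMap (ContinuousLinearMap.id ℂ ℂ)) y) :
    expandGermParam x ∈ Set.range (algebraMap (separatedClosure ℂ MeroGerm MeroSeries)⟦X⟧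
      MeroSeries⟦X⟧) := by
  refine ⟨PowerSeries.mk fun n => ⟨_, hl (coeff n (germTaylor ℂ y))⟩, ?_⟩
  rw [expandGermParam_apply, hx, germTaylor_pullback, algebraMap_apply'']
  ext n
  rw [coeff_map, coeff_mk, coeff_map, coeff_map]
  rfl

/-- Let `H((t, s), ε)` be a Nash function `G` of functions each of which depends on `ε` and only one of
`t` and `s`. Then `H` and its first two `ε`-derivatives at `ε = 0` are algebraic over functions of
`t` and `s` with separated variables: `H` is algebraic over the series in `ε` with coefficients in
the relatively algebraically closed field `separatedClosure`, so that its coefficients lie there. -/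
theorem isSepAlgebraic_nash {σ : Type*} [Fintype σ] {x : σ → (ℂ × ℂ) × ℂ → ℂ}
    (hx : ∀ i, ∃ (l : ℂ × ℂ →L[ℂ] ℂ) (a : ℂ × ℂ → ℂ), AnalyticAt ℂ a 0 ∧
      (l = ContinuousLinearMap.fst ℂ ℂ ℂ ∨ l = ContinuousLinearMap.snd ℂ ℂ ℂ) ∧
      ∀ p, x i p = a (l p.1, p.2))
    {G : (σ → ℂ) → ℂ} (hG : AnalyticAt ℂ G (fun i => x i 0))
    {P : Polynomial (MvPolynomial σ ℂ)} (hP : P ≠ 0)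
    (hPG : ∀ᶠ y in 𝓝 (fun i => x i 0), P.eval₂ (MvPolynomial.eval y) (G y) = 0)
    {H : (ℂ × ℂ) × ℂ → ℂ} (hH : ∀ p, H p = G (fun i => x i p)) :
    AnalyticAt ℂ H 0 ∧
    IsSepAlgebraic (fun p => H (p, 0)) ∧
    IsSepAlgebraic (fun p => fderiv ℂ H (p, 0) (0, 1)) ∧
    IsSepAlgebraic (fun p => fderiv ℂ (fun q => fderiv ℂ H q (0, 1)) (p, 0) (0, 1)) := by
  obtain rfl : H = fun p => G (fun i => x i p) := funext hH
  choose l a ha hl hxa using hx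
  have hax : ∀ i, AnalyticAt ℂ (x i) 0 := fun i => by
    have := AnalyticAt.fun_comp (g := a i)
      (f := (l i).prodMap (ContinuousLinearMap.id ℂ ℂ)) (x := 0)
      (by rw [map_zero]; exact ha i) (ContinuousLinearMap.analyticAt _ _)
    exact this.congr (Filter.Eventually.of_forall fun p => (hxa i p).symm)
  have hHa : AnalyticAt ℂ (fun p => G (fun i => x i p)) 0 :=
    AnalyticAt.fun_comp (g := G) hG (AnalyticAt.pi hax)
  have hst : IsScalarTower ℂ (separatedClosure ℂ MeroGerm MeroSeries)⟦X⟧ MeroSeries⟦X⟧ := by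
    refine IsScalarTower.of_algebraMap_eq fun r => ?_
    rw [algebraMap_apply'', PowerSeries.algebraMap_apply, PowerSeries.algebraMap_apply, map_C,
      ← IsScalarTower.algebraMap_apply]
  have halg := isAlgebraic_nash (R := (separatedClosure ℂ MeroGerm MeroSeries)⟦X⟧)
    expandGermParam hax (fun i => ?_) hG hP hPG hHa
  · have hc := coeff_mem_of_isAlgebraic (fun _ => mem_separatedClosure_of_isAlgebraic) halg
    have hc' : ∀ n, expandGermField (pullback (ContinuousLinearMap.inl ℂ (ℂ × ℂ) ℂ)
        ((germDeriv ((0 : ℂ × ℂ), (1 : ℂ)))^[n] (toGerm _ hHa))) ∈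
          separatedClosure ℂ MeroGerm MeroSeries := by
      intro n
      have h1 := hc n
      rw [expandGermParam_apply, coeff_map, coeff_germTaylor] at h1
      change expandGermField _ ∈ _ at h1
      rw [map_smul] at h1
      have h2 := (separatedClosure ℂ MeroGerm MeroSeries).smul_mem h1 (x := (n.factorial : ℂ))
      rwa [smul_smul, mul_inv_cancel₀ (by exact_mod_cast n.factorial_ne_zero), one_smul] at h2
    refine ⟨hHa, ⟨_, hc' 0⟩, ?_, ?_⟩
    · have := hc' 1
      rw [Function.iterate_one, germDeriv_toGerm, pullback_toGerm] at this
      exact ⟨_, this⟩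
    · have := hc' 2
      rw [Function.iterate_succ_apply, Function.iterate_one, germDeriv_toGerm, germDeriv_toGerm,
        pullback_toGerm] at this
      exact ⟨_, this⟩
  · refine expandGermParam_mem_range (l i) ?_ (y := toGerm (a i) (ha i)) ?_
    · rcases hl i with h | h <;> rw [h]
      exacts [expandGermField_fst_mem, expandGermField_snd_mem]
    · rw [pullback_toGerm]
      exact toGerm_congr _ (funext fun p => hxa i p)

/-! ### Functional independence of Nash functions and logarithmic derivatives -/

theorem derivative_expandGerm (x : AnalyticGerm (ℂ × ℂ)) :
    d⁄dX MeroGerm (expandGerm x) = expandGerm (germDeriv ((0 : ℂ), (1 : ℂ)) x) := by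
  rw [expandGerm_apply, expandGerm_apply, ← derivative_germTaylor]
  ext n
  simp [coeff_derivative]

theorem constantCoeff_expandGerm (x : AnalyticGerm (ℂ × ℂ)) :
    constantCoeff (expandGerm x) = meroOfGerm (pullback (ContinuousLinearMap.inl ℂ ℂ ℂ) x) := by
  rw [expandGerm_apply, ← constantCoeff_germTaylor, ← coeff_zero_eq_constantCoeff_apply, coeff_map,
    coeff_zero_eq_constantCoeff_apply]
  rfl

theorem meroOfGerm_toGerm_ne_zero {f : ℂ → ℂ} (hf : AnalyticAt ℂ f 0) (h0 : f 0 ≠ 0) :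
    meroOfGerm (toGerm f hf) ≠ 0 := by
  rw [Ne, ← map_zero meroOfGerm, meroOfGerm_injective.eq_iff, ← map_zero (algebraMap ℂ _),
    ← toGerm_const, toGerm_eq_iff]
  exact fun h => h0 h.self_of_nhds

theorem constantCoeff_expandGerm_ne_zero {f : ℂ × ℂ → ℂ} (hf : AnalyticAt ℂ f 0) (h0 : f 0 ≠ 0) :
    constantCoeff (expandGerm (toGerm f hf)) ≠ 0 := by
  rw [constantCoeff_expandGerm, pullback_toGerm]
  exact meroOfGerm_toGerm_ne_zero _ h0

/-- A meromorphic germ that is algebraic over `ℂ` is constant. -/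
theorem eventually_eq_of_isAlgebraic {f : ℂ → ℂ} (hf : AnalyticAt ℂ f 0)
    (h : IsAlgebraic ℂ (meroOfGerm (toGerm f hf))) : ∀ᶠ t in 𝓝 0, f t = f 0 := by
  obtain ⟨c, hc⟩ := minpoly.mem_range_of_degree_eq_one ℂ _
    (IsAlgClosed.degree_eq_one_of_irreducible ℂ (minpoly.irreducible h.isIntegral))
  rw [← meroOfGerm.commutes, meroOfGerm_injective.eq_iff, ← toGerm_const, toGerm_eq_iff] at hc
  filter_upwards [hc] with t ht
  rw [← ht, ← hc.self_of_nhds]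

theorem toGerm_sum {V ι : Type*} [NormedAddCommGroup V] [NormedSpace ℂ V] (s : Finset ι)
    {f : ι → V → ℂ} (hf : ∀ i, AnalyticAt ℂ (f i) 0) :
    toGerm (fun x => ∑ i ∈ s, f i x) (s.analyticAt_fun_sum fun i _ => hf i) =
      ∑ i ∈ s, toGerm (f i) (hf i) := by
  classical
  induction s using Finset.induction_on with
  | empty => exact (toGerm_const 0).trans (map_zero _)
  | insert a s ha ih =>
    rw [Finset.sum_insert ha, ← ih, ← toGerm_add]
    exact toGerm_congr _ (by simp only [Finset.sum_insert ha])

/-- If `Φ` and the `A i` are algebraic over functions with separated variables `t, s`,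
`Φ(t, 0)` is constant, and `∂Φ/∂s - ∑ c i ∂(log A i)/∂s` is a function of `s` alone, then
`∂²Φ/∂t∂s` vanishes at the origin. -/
theorem IsSepAlgebraic.fderiv_fderiv_eq_zero {ι : Type*} [Fintype ι] {Φ : ℂ × ℂ → ℂ}
    {A : ι → ℂ × ℂ → ℂ} (c : ι → ℂ) (hΦ : IsSepAlgebraic Φ) (hA : ∀ i, IsSepAlgebraic (A i))
    (hA0 : ∀ i, A i 0 ≠ 0) (hΦ0 : ∀ᶠ t in 𝓝 (0 : ℂ), Φ (t, 0) = Φ 0) {Z : ℂ → ℂ}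
    (hZ : AnalyticAt ℂ Z 0)
    (h : ∀ᶠ p in 𝓝 (0 : ℂ × ℂ), fderiv ℂ Φ p (0, 1) =
      Z p.2 + ∑ i, c i * (fderiv ℂ (A i) p (0, 1) * (A i p)⁻¹)) :
    fderiv ℂ (fun p => fderiv ℂ Φ p (0, 1)) 0 (1, 0) = 0 := by
  obtain ⟨hΦa, hΦK⟩ := hΦ
  choose hAa hAK using hA
  have hinv : ∀ i, expandGerm (toGerm (fun p => (A i p)⁻¹) ((hAa i).inv (hA0 i))) =
      (expandGerm (toGerm (A i) (hAa i)))⁻¹ := by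
    intro i
    rw [PowerSeries.eq_inv_iff_mul_eq_one (constantCoeff_expandGerm_ne_zero _ (hA0 i)), ← map_mul,
      ← map_one expandGerm]
    congr 1
    rw [← toGerm_mul, ← map_one (algebraMap ℂ _), ← toGerm_const]
    refine toGerm_eq_iff.mpr ?_
    filter_upwards [(hAa i).continuousAt.eventually_ne (hA0 i)] with x hx
    exact inv_mul_cancel₀ hx
  have hterm : ∀ i, AnalyticAt ℂ
      (fun p : ℂ × ℂ => c i * (fderiv ℂ (A i) p (0, 1) * (A i p)⁻¹)) 0 := fun i =>
    analyticAt_const.mul (((hAa i).fderiv_apply (0, 1)).mul ((hAa i).inv (hA0 i)))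
  have hgerm : germDeriv ((0 : ℂ), (1 : ℂ)) (toGerm Φ hΦa) =
      pullback (ContinuousLinearMap.snd ℂ ℂ ℂ) (toGerm Z hZ) + ∑ i, algebraMap ℂ _ (c i) *
        (germDeriv ((0 : ℂ), (1 : ℂ)) (toGerm (A i) (hAa i)) *
          toGerm (fun p => (A i p)⁻¹) ((hAa i).inv (hA0 i))) := by
    have hsum : ∑ i, algebraMap ℂ _ (c i) * (germDeriv ((0 : ℂ), (1 : ℂ)) (toGerm (A i) (hAa i)) *
        toGerm (fun p => (A i p)⁻¹) ((hAa i).inv (hA0 i))) =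
        toGerm (fun p : ℂ × ℂ => ∑ i, c i * (fderiv ℂ (A i) p (0, 1) * (A i p)⁻¹))
          (Finset.univ.analyticAt_fun_sum fun i _ => hterm i) := by
      simp only [germDeriv_toGerm, ← toGerm_mul, ← toGerm_const]
      exact (toGerm_sum Finset.univ hterm).symm
    rw [hsum, germDeriv_toGerm, pullback_toGerm, ← toGerm_add]
    exact toGerm_eq_iff.mpr h
  obtain ⟨p, hp⟩ := expandGerm_snd (toGerm Z hZ)
  have halg : IsAlgebraic ℂ (coeff 1 (expandGerm (toGerm Φ hΦa))) := by
    refine isAlgebraic_coeff_one (L := MeroSeries) (b := Φ 0) (p := p) (expandGerm (toGerm Φ hΦa))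
      (fun i => expandGerm (toGerm (A i) (hAa i))) c
      (fun i => constantCoeff_expandGerm_ne_zero _ (hA0 i)) ?_ hΦK hAK ?_
    · rw [constantCoeff_expandGerm, ← meroOfGerm.commutes]
      congr 1
      rw [pullback_toGerm, ← toGerm_const]
      exact toGerm_eq_iff.mpr hΦ0
    · have := congrArg expandGerm hgerm
      rw [← derivative_expandGerm, map_add, hp, map_sum] at this
      rw [this]
      congr 1
      refine Finset.sum_congr rfl fun i _ => ?_
      rw [map_mul, map_mul, hinv, ← derivative_expandGerm, expandGerm.commutes,
        PowerSeries.algebraMap_apply]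
  have h1 : coeff 1 (expandGerm (toGerm Φ hΦa)) =
      constantCoeff (d⁄dX MeroGerm (expandGerm (toGerm Φ hΦa))) := by
    rw [← coeff_zero_eq_constantCoeff_apply, coeff_derivative]
    simp
  rw [h1, derivative_expandGerm, constantCoeff_expandGerm, germDeriv_toGerm, pullback_toGerm] at halg
  have hconst := eventually_eq_of_isAlgebraic _ halg
  have hd : HasFDerivAt (fun p => fderiv ℂ Φ p (0, 1)) _ ((0 : ℂ), (0 : ℂ)) :=
    (hΦa.fderiv_apply (0, 1)).differentiableAt.hasFDerivAt
  have h2 := (HasFDerivAt.comp (f := fun t : ℂ => (t, (0 : ℂ))) (0 : ℂ) hd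
    (hasFDerivAt_prodMk_left (𝕜 := ℂ) (0 : ℂ) (0 : ℂ))).fderiv
  have h3 : fderiv ℂ ((fun p => fderiv ℂ Φ p (0, 1)) ∘ fun t : ℂ => (t, (0 : ℂ))) 0 = 0 := by
    rw [Filter.EventuallyEq.fderiv_eq
      (f₁ := (fun p => fderiv ℂ Φ p (0, 1)) ∘ fun t : ℂ => (t, (0 : ℂ)))
      (f := fun _ => fderiv ℂ Φ 0 (0, 1)) hconst]
    simp
  have h4 := DFunLike.congr_fun (h2.symm.trans h3) 1
  simpa using h4

/-- A function with `∂G/∂t = 0` near the origin is a function of `s` alone. -/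
theorem AnalyticAt.eventually_eq_of_fderiv_fst_eq_zero {G : ℂ × ℂ → ℂ} (hG : AnalyticAt ℂ G 0)
    (h : ∀ᶠ p in 𝓝 (0 : ℂ × ℂ), fderiv ℂ G p (1, 0) = 0) :
    ∀ᶠ p in 𝓝 (0 : ℂ × ℂ), G p = G (0, p.2) := by
  obtain ⟨ε, hε, hball⟩ := Metric.eventually_nhds_iff_ball.mp (h.and hG.eventually_analyticAt)
  filter_upwards [Metric.ball_mem_nhds (0 : ℂ × ℂ) hε] with p hp
  rw [mem_ball_zero_iff, Prod.norm_def, max_lt_iff] at hp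
  have hmem : ∀ t ∈ Metric.ball (0 : ℂ) ε, (t, p.2) ∈ Metric.ball (0 : ℂ × ℂ) ε := by
    intro t ht
    rw [mem_ball_zero_iff, Prod.norm_def, max_lt_iff]
    exact ⟨mem_ball_zero_iff.mp ht, hp.2⟩
  have hder : ∀ t ∈ Metric.ball (0 : ℂ) ε, HasFDerivAt (fun t => G (t, p.2))
      ((fderiv ℂ G (t, p.2)).comp (ContinuousLinearMap.inl ℂ ℂ ℂ)) t := fun t ht =>
    (hball _ (hmem t ht)).2.differentiableAt.hasFDerivAt.comp t (hasFDerivAt_prodMk_left t p.2)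
  refine (convex_ball (0 : ℂ) ε).is_const_of_fderivWithin_eq_zero (𝕜 := ℂ) (f := fun t => G (t, p.2))
    (fun t ht => (hder t ht).differentiableAt.differentiableWithinAt) (fun t ht => ?_)
    (mem_ball_zero_iff.mpr hp.1) (Metric.mem_ball_self hε)
  rw [fderivWithin_of_isOpen Metric.isOpen_ball ht, (hder t ht).fderiv]
  ext
  simpa using (hball _ (hmem t ht)).1

end series

/-! ### Complex conjugation and polarization -/

section conj

variable {E F : Type*} [NormedAddCommGroup E] [NormedSpace ℂ E] [StarAddMonoid E]
  [NormedStarGroup E] [StarModule ℂ E] [NormedAddCommGroup F] [NormedSpace ℂ F] [StarAddMonoid F]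
  [NormedStarGroup F] [StarModule ℂ F]

/-- The multilinear map `v ↦ star (p (star v))`. -/
def ContinuousMultilinearMap.starConj {n : ℕ} (p : E [×n]→L[ℂ] F) : E [×n]→L[ℂ] F where
  toFun v := star (p fun i => star (v i))
  map_update_add' {_} v i x y := by
    have h : ∀ z, (fun j => star (Function.update v i z j)) =
        Function.update (fun j => star (v j)) i (star z) := by
      intro z
      funext j
      by_cases hj : j = i
      · subst hj; simp
      · simp [hj]
    rw [h, h, h, star_add, p.map_update_add, star_add]
  map_update_smul' {_} v i c x := by
    have h : ∀ z, (fun j => star (Function.update v i z j)) =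
        Function.update (fun j => star (v j)) i (star z) := by
      intro z
      funext j
      by_cases hj : j = i
      · subst hj; simp
      · simp [hj]
    rw [h, h, star_smul, p.map_update_smul, star_smul, star_star]
  cont := by
    refine continuous_star.comp (p.cont.comp ?_)
    exact continuous_pi fun i => continuous_star.comp (continuous_apply i)

theorem ContinuousMultilinearMap.norm_starConj_le {n : ℕ} (p : E [×n]→L[ℂ] F) :
    ‖p.starConj‖ ≤ ‖p‖ := by
  refine ContinuousMultilinearMap.opNorm_le_bound (norm_nonneg _) fun v => ?_
  change ‖star (p fun i => star (v i))‖ ≤ _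
  rw [norm_star]
  exact (p.le_opNorm _).trans (by simp)

/-- If `f` is holomorphic, then so is `v ↦ star (f (star v))`. -/
theorem AnalyticAt.star_star {f : E → F} {x : E} (hf : AnalyticAt ℂ f x) :
    AnalyticAt ℂ (fun v => star (f (star v))) (star x) := by
  obtain ⟨p, r, hp⟩ := hf
  refine ⟨fun n => (p n).starConj, r, ?_, hp.r_pos, fun {y} hy => ?_⟩
  · refine hp.r_le.trans (FormalMultilinearSeries.radius_le_of_le fun n => ?_)
    exact (p n).norm_starConj_le
  · have hy' : star y ∈ Metric.eball (0 : E) r := by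
      simpa [edist_eq_enorm_sub, enorm_eq_nnnorm] using hy
    have : HasSum (fun n => star (p n fun _ => star y)) (star (f (x + star y))) :=
      (hp.hasSum hy').star
    rw [star_add, _root_.star_star]
    exact this

/-- A holomorphic function of two variables that vanishes on the antidiagonal `{(z, star z)}` near
a point vanishes near that point. -/
theorem AnalyticAt.eventually_eq_zero_of_star {H : E × E → ℂ} {a : E}
    (hH : AnalyticAt ℂ H (a, star a)) (h : ∀ᶠ z in 𝓝 a, H (z, star z) = 0) :
    ∀ᶠ p in 𝓝 (a, star a), H p = 0 := by
  obtain ⟨ε, hε, hb⟩ := Metric.eventually_nhds_iff_ball.mp hH.eventually_analyticAt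
  obtain ⟨δ, hδ, hd⟩ := Metric.eventually_nhds_iff_ball.mp h
  have hpos : 0 < min ε δ / 3 := by positivity
  filter_upwards [Metric.ball_mem_nhds _ hpos] with q hq
  obtain ⟨p, rfl⟩ : ∃ p, q = (a, star a) + p := ⟨q - (a, star a), by abel⟩
  have hp : ‖p‖ < min ε δ / 3 := by simpa [dist_eq_norm] using hq
  have hpε : 3 * ‖p‖ < ε := by linarith [min_le_left ε δ]
  have hpδ : 3 * ‖p‖ < δ := by linarith [min_le_right ε δ]
  -- `p = p₁ + i p₂`, where `p₁` and `p₂` lie on the antidiagonal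
  let x₁ : E := (1 / 2 : ℂ) • (p.1 + star p.2)
  let x₂ : E := (-Complex.I / 2 : ℂ) • (p.1 - star p.2)
  have hI : Complex.I * (-Complex.I / 2) = 1 / 2 := by
    rw [mul_div_assoc', mul_neg, Complex.I_mul_I, neg_neg]
  have e1 : x₁ + Complex.I • x₂ = p.1 := by
    simp only [x₁, x₂, smul_smul, hI, ← smul_add, add_add_sub_cancel, ← two_smul ℂ p.1]
    norm_num
  have s1 : star x₁ = (1 / 2 : ℂ) • (star p.1 + p.2) := by
    simp [x₁, star_smul]
  have s2 : star x₂ = (Complex.I / 2 : ℂ) • (star p.1 - p.2) := by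
    simp [x₂, star_smul]
  have e2 : star x₁ + Complex.I • star x₂ = p.2 := by
    have hI2 : Complex.I * (Complex.I / 2) = -(1 / 2) := by
      rw [mul_div_assoc', Complex.I_mul_I, neg_div]
    rw [s1, s2, smul_smul, hI2, neg_smul, ← sub_eq_add_neg, ← smul_sub, add_sub_sub_cancel,
      ← two_smul ℂ p.2, smul_smul]
    norm_num
  have n1 : ‖x₁‖ ≤ ‖p‖ := by
    have := norm_add_le p.1 (star p.2)
    rw [norm_star] at this
    rw [norm_smul]
    have h1 := norm_fst_le p
    have h2 := norm_snd_le p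
    norm_num
    linarith
  have n2 : ‖x₂‖ ≤ ‖p‖ := by
    have := norm_sub_le p.1 (star p.2)
    rw [norm_star] at this
    rw [norm_smul]
    have h1 := norm_fst_le p
    have h2 := norm_snd_le p
    norm_num
    linarith
  -- the function `τ ↦ H (p₁ + τ p₂)` vanishes for small real `τ`, hence for `τ = i`
  let c : ℂ → E × E := fun τ => (a, star a) + (x₁ + τ • x₂, star x₁ + τ • star x₂)
  have hc : AnalyticOnNhd ℂ (fun τ => H (c τ)) (Metric.ball 0 2) := by
    intro τ hτ
    have hτ' : ‖τ‖ ≤ 2 := (mem_ball_zero_iff.mp hτ).le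
    refine AnalyticAt.fun_comp (g := H) (hb _ ?_) (by fun_prop)
    have b : ∀ x y : E, ‖x‖ ≤ ‖p‖ → ‖y‖ ≤ ‖p‖ → ‖x + τ • y‖ ≤ 3 * ‖p‖ := by
      intro x y hx hy
      have h1 := norm_add_le x (τ • y)
      rw [norm_smul] at h1
      nlinarith [norm_nonneg y, norm_nonneg τ]
    rw [Metric.mem_ball, dist_eq_norm, add_sub_cancel_left, Prod.norm_def, max_lt_iff]
    exact ⟨(b _ _ n1 n2).trans_lt hpε,
      (b _ _ ((norm_star _).le.trans n1) ((norm_star _).le.trans n2)).trans_lt hpε⟩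
  have hreal : ∀ τ : ℝ, |τ| < 1 → H (c τ) = 0 := by
    intro τ hτ
    have : c τ = (a + (x₁ + (τ : ℂ) • x₂), star (a + (x₁ + (τ : ℂ) • x₂))) := by
      simp [c, star_add, star_smul]
    rw [this]
    refine hd _ ?_
    rw [Metric.mem_ball, dist_eq_norm, add_sub_cancel_left]
    have h1 := norm_add_le x₁ ((τ : ℂ) • x₂)
    rw [norm_smul (τ : ℂ) x₂, Complex.norm_real, Real.norm_eq_abs] at h1
    nlinarith [norm_nonneg x₂, abs_nonneg τ]
  have hfreq : ∃ᶠ τ in 𝓝[≠] (0 : ℂ), H (c τ) = 0 := by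
    have ht : Filter.Tendsto (fun τ : ℝ => (τ : ℂ)) (𝓝[≠] 0) (𝓝[≠] 0) := by
      refine tendsto_nhdsWithin_iff.mpr ⟨?_, ?_⟩
      · exact (Complex.continuous_ofReal.tendsto' 0 0 (by simp)).mono_left nhdsWithin_le_nhds
      · filter_upwards [self_mem_nhdsWithin] with τ hτ
        simpa using hτ
    refine ht.frequently (Filter.Eventually.frequently ?_)
    refine nhdsWithin_le_nhds ?_
    filter_upwards [Metric.ball_mem_nhds (0 : ℝ) one_pos] with τ hτ
    exact hreal τ (by simpa using hτ)
  have hz := hc.eqOn_zero_of_preconnected_of_frequently_eq_zero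
    (convex_ball (0 : ℂ) 2).isPreconnected (Metric.mem_ball_self two_pos) hfreq
  have hI := hz (show Complex.I ∈ Metric.ball (0 : ℂ) 2 by simp)
  have hcI : c Complex.I = (a, star a) + p := by
    simp only [c, e1, e2]
  simpa [hcI] using hI

end conj

/-! ### The polarized complex Hessian -/

section mixedHessian

variable {E E' : Type*} [NormedAddCommGroup E] [NormedSpace ℂ E] [NormedAddCommGroup E']
  [NormedSpace ℂ E']

/-- The mixed second derivative `∂²T/∂z∂w` of a holomorphic function `T(z, w)` in the direction `x`
for `z` and `y` for `w`. If `T` is the complex extension of a real analytic function, its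
restriction to `w = z̄` is the complex Hessian of that function. -/
def mixedHessian (T : E × E → ℂ) (p : E × E) (x y : E) : ℂ :=
  fderiv ℂ (fun p' => fderiv ℂ T p' (0, y)) p (x, 0)

theorem fderiv_fderiv_apply {T : E → ℂ} {p : E} (hT : AnalyticAt ℂ T p) (v w : E) :
    fderiv ℂ (fun p' => fderiv ℂ T p' w) p v = fderiv ℂ (fderiv ℂ T) p v w := by
  rw [fderiv_clm_apply hT.fderiv.differentiableAt (by fun_prop)]
  simp

theorem mixedHessian_eq {T : E × E → ℂ} {p : E × E} (hT : AnalyticAt ℂ T p) (x y : E) :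
    mixedHessian T p x y = fderiv ℂ (fderiv ℂ T) p (x, 0) (0, y) :=
  fderiv_fderiv_apply hT _ _

theorem AnalyticAt.mixedHessian {T : E × E → ℂ} {p : E × E} (hT : AnalyticAt ℂ T p) (x y : E) :
    AnalyticAt ℂ (fun p => mixedHessian T p x y) p :=
  (hT.fderiv_apply _).fderiv_apply _

theorem fderiv_add_sum {ι : Type*} [Fintype ι] {T : E → ℂ} {S : ι → E → ℂ} (c : ι → ℂ) {p : E}
    (hT : AnalyticAt ℂ T p) (hS : ∀ i, AnalyticAt ℂ (S i) p) (v : E) :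
    fderiv ℂ (fun p => T p + ∑ i, c i * S i p) p v =
      fderiv ℂ T p v + ∑ i, c i * fderiv ℂ (S i) p v := by
  rw [fderiv_fun_add hT.differentiableAt (by fun_prop (disch := exact (hS _).differentiableAt)),
    fderiv_fun_sum fun i _ => (hS i).differentiableAt.const_mul (c i)]
  simp only [add_apply, sum_apply]
  congr 1
  refine Finset.sum_congr rfl fun i _ => ?_
  rw [fderiv_const_mul (hS i).differentiableAt]
  rfl

theorem mixedHessian_add_sum {ι : Type*} [Fintype ι] {T : E × E → ℂ} {S : ι → E × E → ℂ}
    (c : ι → ℂ) {p : E × E} (hT : AnalyticAt ℂ T p) (hS : ∀ i, AnalyticAt ℂ (S i) p) (x y : E) :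
    mixedHessian (fun p => T p + ∑ i, c i * S i p) p x y =
      mixedHessian T p x y + ∑ i, c i * mixedHessian (S i) p x y := by
  unfold mixedHessian
  rw [← fderiv_add_sum c (hT.fderiv_apply _) (fun i => (hS i).fderiv_apply _),
    Filter.EventuallyEq.fderiv_eq]
  filter_upwards [hT.eventually_analyticAt,
    Filter.eventually_all.mpr fun i => (hS i).eventually_analyticAt] with p' h1 h2
  exact fderiv_add_sum c h1 h2 _

theorem fderiv_clog {T : E → ℂ} {p : E} (hT : AnalyticAt ℂ T p) (h : T p ∈ Complex.slitPlane)
    (v : E) : fderiv ℂ (fun p => Complex.log (T p)) p v = fderiv ℂ T p v * (T p)⁻¹ := by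
  rw [(hT.differentiableAt.hasFDerivAt.clog h).fderiv]
  simp [mul_comm]

theorem mixedHessian_clog {T : E × E → ℂ} {p : E × E} (hT : AnalyticAt ℂ T p)
    (h : T p ∈ Complex.slitPlane) (x y : E) :
    mixedHessian (fun p => Complex.log (T p)) p x y =
      mixedHessian T p x y * (T p)⁻¹ +
        (-1) * (fderiv ℂ T p (x, 0) * fderiv ℂ T p (0, y) * ((T p)⁻¹ * (T p)⁻¹)) := by
  have h0 : T p ≠ 0 := Complex.slitPlane_ne_zero h
  have h1 : (fun p => fderiv ℂ (fun p => Complex.log (T p)) p (0, y)) =ᶠ[𝓝 p]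
      fun p => fderiv ℂ T p (0, y) * (T p)⁻¹ := by
    filter_upwards [hT.eventually_analyticAt,
      hT.continuousAt.eventually_mem (Complex.isOpen_slitPlane.mem_nhds h)] with p' h1 h2
    exact fderiv_clog h1 h2 _
  unfold mixedHessian
  rw [h1.fderiv_eq]
  have h2 := ((hT.fderiv_apply (0, y)).differentiableAt.hasFDerivAt.mul
    ((hasDerivAt_inv h0).comp_hasFDerivAt p hT.differentiableAt.hasFDerivAt)).fderiv
  refine (DFunLike.congr_fun h2 (x, 0)).trans ?_
  simp
  ring

/-- Chain rule for holomorphic substitutions in the two groups of variables. -/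
theorem hasFDerivAt_comp_prodMap {T : E × E → ℂ} {α β : E' → E} {w : E' × E'}
    (hT : AnalyticAt ℂ T (α w.1, β w.2)) (hα : AnalyticAt ℂ α w.1) (hβ : AnalyticAt ℂ β w.2) :
    HasFDerivAt (fun w : E' × E' => T (α w.1, β w.2))
      ((fderiv ℂ T (α w.1, β w.2)).comp ((fderiv ℂ α w.1).prodMap (fderiv ℂ β w.2))) w :=
  HasFDerivAt.comp (f := fun w : E' × E' => (α w.1, β w.2)) w hT.differentiableAt.hasFDerivAt
    (hα.differentiableAt.hasFDerivAt.prodMap w hβ.differentiableAt.hasFDerivAt)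

theorem analyticAt_comp_prodMap {T : E × E → ℂ} {α β : E' → E} {w : E' × E'}
    (hT : AnalyticAt ℂ T (α w.1, β w.2)) (hα : AnalyticAt ℂ α w.1) (hβ : AnalyticAt ℂ β w.2) :
    AnalyticAt ℂ (fun w : E' × E' => T (α w.1, β w.2)) w :=
  AnalyticAt.fun_comp (g := T) (f := fun w : E' × E' => (α w.1, β w.2)) hT
    ((AnalyticAt.fun_comp (g := α) hα analyticAt_fst).prod
      (AnalyticAt.fun_comp (g := β) hβ analyticAt_snd))

theorem eventually_comp_prodMap {α β : E' → E} {w : E' × E'} {P : E × E → Prop}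
    (hα : AnalyticAt ℂ α w.1) (hβ : AnalyticAt ℂ β w.2) (h : ∀ᶠ p in 𝓝 (α w.1, β w.2), P p) :
    ∀ᶠ v in 𝓝 w, P (α v.1, β v.2) := by
  have : Filter.Tendsto (fun v : E' × E' => (α v.1, β v.2)) (𝓝 w) (𝓝 (α w.1, β w.2)) :=
    ContinuousAt.tendsto (f := fun v : E' × E' => (α v.1, β v.2))
      ((ContinuousAt.comp (g := α) hα.continuousAt continuousAt_fst).prodMk
        (ContinuousAt.comp (g := β) hβ.continuousAt continuousAt_snd))
  exact this.eventually h

/-- Chain rule for the mixed second derivative: since each of `z`, `w` is substituted separately, no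
second derivatives of the substitutions occur. -/
theorem mixedHessian_comp_prodMap [CompleteSpace E] {T : E × E → ℂ} {α β : E' → E} {w : E' × E'}
    (hT : AnalyticAt ℂ T (α w.1, β w.2)) (hα : AnalyticAt ℂ α w.1) (hβ : AnalyticAt ℂ β w.2)
    (x y : E') :
    mixedHessian (fun w : E' × E' => T (α w.1, β w.2)) w x y =
      mixedHessian T (α w.1, β w.2) (fderiv ℂ α w.1 x) (fderiv ℂ β w.2 y) := by
  have h1 : (fun w' : E' × E' => fderiv ℂ (fun w : E' × E' => T (α w.1, β w.2)) w' (0, y)) =ᶠ[𝓝 w]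
      fun w' => fderiv ℂ T (α w'.1, β w'.2) (0, fderiv ℂ β w'.2 y) := by
    filter_upwards [eventually_comp_prodMap hα hβ hT.eventually_analyticAt,
      continuousAt_fst.eventually hα.eventually_analyticAt,
      continuousAt_snd.eventually hβ.eventually_analyticAt] with w' a1 a2 a3
    rw [(hasFDerivAt_comp_prodMap a1 a2 a3).fderiv]
    simp
  have hc : HasFDerivAt (fun w' : E' × E' => fderiv ℂ T (α w'.1, β w'.2))
      ((fderiv ℂ (fderiv ℂ T) (α w.1, β w.2)).comp ((fderiv ℂ α w.1).prodMap (fderiv ℂ β w.2))) w :=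
    HasFDerivAt.comp (f := fun w : E' × E' => (α w.1, β w.2)) w
      hT.fderiv.differentiableAt.hasFDerivAt
      (hα.differentiableAt.hasFDerivAt.prodMap w hβ.differentiableAt.hasFDerivAt)
  have hu : HasFDerivAt (fun w' : E' × E' => ((0 : E), fderiv ℂ β w'.2 y))
      ((ContinuousLinearMap.inr ℂ E E).comp ((fderiv ℂ (fun v => fderiv ℂ β v y) w.2).comp
        (ContinuousLinearMap.snd ℂ E' E'))) w :=
    (ContinuousLinearMap.inr ℂ E E).hasFDerivAt.comp w
      (HasFDerivAt.comp (f := Prod.snd) (g := fun v => fderiv ℂ β v y) w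
        (hβ.fderiv.differentiableAt.clm_apply (differentiableAt_const y)).hasFDerivAt hasFDerivAt_snd)
  rw [mixedHessian_eq hT, mixedHessian, h1.fderiv_eq, (hc.clm_apply hu).fderiv]
  simp [show ((0 : E), (0 : E)) = 0 from rfl]

end mixedHessian

/-! ### Wirtinger derivatives of functions with a complex extension -/

section wirtinger

variable {n : ℕ}

theorem fderiv_real_of_eventually_eq {F : CSpace n → ℂ} {T : CSpace n × CSpace n → ℂ}
    {z : CSpace n} (hT : DifferentiableAt ℂ T (z, star z)) (h : ∀ᶠ z' in 𝓝 z, T (z', star z') = F z')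
    (v : CSpace n) : fderiv ℝ F z v = fderiv ℂ T (z, star z) (v, star v) := by
  have h1 : HasFDerivAt (fun z : CSpace n => T (z, star z))
      (((fderiv ℂ T (z, star z)).restrictScalars ℝ).comp
        ((ContinuousLinearMap.id ℝ (CSpace n)).prod (starL' ℝ : CSpace n ≃L[ℝ] CSpace n))) z :=
    HasFDerivAt.comp (f := fun z : CSpace n => (z, star z)) z (hT.hasFDerivAt.restrictScalars ℝ)
      ((hasFDerivAt_id z).prodMk (starL' ℝ : CSpace n ≃L[ℝ] CSpace n).hasFDerivAt)
  rw [(h1.congr_of_eventuallyEq (h.mono fun _ h => h.symm)).fderiv]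
  rfl

theorem wirtingerDz_eq {F : CSpace n → ℂ} {T : CSpace n × CSpace n → ℂ}
    {z : CSpace n} (hT : DifferentiableAt ℂ T (z, star z)) (h : ∀ᶠ z' in 𝓝 z, T (z', star z') = F z')
    (j : Fin n) : wirtingerDz j F z = fderiv ℂ T (z, star z) (Pi.single j 1, 0) := by
  have e : ∀ c : ℂ, ((Pi.single j c, star (Pi.single j c)) : CSpace n × CSpace n) =
      c • (Pi.single j (1 : ℂ), (0 : CSpace n)) + (star c) • ((0 : CSpace n), Pi.single j (1 : ℂ)) := by
    intro c
    rw [← Pi.single_star]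
    ext i <;> by_cases hi : i = j <;> simp [hi]
  rw [wirtingerDz, fderiv_real_of_eventually_eq hT h, fderiv_real_of_eventually_eq hT h, e, e]
  simp only [map_add, map_smul, smul_eq_mul, star_one, Complex.star_def, Complex.conj_I]
  linear_combination (-(1 / 2) * (fderiv ℂ T (z, star z)) (Pi.single j 1, 0) +
    (1 / 2) * (fderiv ℂ T (z, star z)) (0, Pi.single j 1)) * Complex.I_sq

theorem wirtingerDzbar_eq {F : CSpace n → ℂ} {T : CSpace n × CSpace n → ℂ}
    {z : CSpace n} (hT : DifferentiableAt ℂ T (z, star z)) (h : ∀ᶠ z' in 𝓝 z, T (z', star z') = F z')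
    (j : Fin n) : wirtingerDzbar j F z = fderiv ℂ T (z, star z) (0, Pi.single j 1) := by
  have e : ∀ c : ℂ, ((Pi.single j c, star (Pi.single j c)) : CSpace n × CSpace n) =
      c • (Pi.single j (1 : ℂ), (0 : CSpace n)) + (star c) • ((0 : CSpace n), Pi.single j (1 : ℂ)) := by
    intro c
    rw [← Pi.single_star]
    ext i <;> by_cases hi : i = j <;> simp [hi]
  rw [wirtingerDzbar, fderiv_real_of_eventually_eq hT h, fderiv_real_of_eventually_eq hT h, e, e]
  simp only [map_add, map_smul, smul_eq_mul, star_one, Complex.star_def, Complex.conj_I]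
  linear_combination ((1 / 2) * (fderiv ℂ T (z, star z)) (Pi.single j 1, 0) -
    (1 / 2) * (fderiv ℂ T (z, star z)) (0, Pi.single j 1)) * Complex.I_sq

theorem tendsto_prodMk_star (a : CSpace n) :
    Filter.Tendsto (fun z : CSpace n => (z, star z)) (𝓝 a) (𝓝 (a, star a)) :=
  (continuous_id.prodMk continuous_star).tendsto a

theorem IsComplexExtensionAt.eventually {u : CSpace n → ℝ} {T : CSpace n × CSpace n → ℂ}
    {a : CSpace n} (h : IsComplexExtensionAt u T a) : ∀ᶠ z in 𝓝 a, IsComplexExtensionAt u T z := by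
  filter_upwards [(tendsto_prodMk_star a).eventually h.1.eventually_analyticAt,
    h.2.eventually_nhds] with z h1 h2
  exact ⟨h1, h2⟩

theorem IsComplexExtensionAt.complexHessian_apply {u : CSpace n → ℝ}
    {T : CSpace n × CSpace n → ℂ} {a : CSpace n} (h : IsComplexExtensionAt u T a) (j k : Fin n) :
    complexHessian u a j k = mixedHessian T (a, star a) (Pi.single j 1) (Pi.single k 1) := by
  change wirtingerDz j (wirtingerDzbar k (fun y => (u y : ℂ))) a = _
  refine wirtingerDz_eq (h.1.fderiv_apply (0, Pi.single k 1)).differentiableAt ?_ j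
  filter_upwards [h.eventually] with z hz
  exact (wirtingerDzbar_eq hz.1.differentiableAt hz.2 k).symm

end wirtinger

/-! ### Nash functions along a line -/

section line

variable {m : ℕ}

/-- The polarization of the line through `a` in the direction `e`, with independent parameters `t`
for `z` and `s` for `z̄`. For real `e`, the points over `s = t̄` are the points `(z, z̄)` of the line. -/
def polarLine (a e : CSpace m) (p : ℂ × ℂ) : CSpace m × CSpace m :=
  (a + p.1 • e, star a + p.2 • e)

theorem polarLine_zero (a e : CSpace m) : polarLine a e 0 = (a, star a) := by
  simp [polarLine]

theorem tendsto_polarLine (a e : CSpace m) :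
    Filter.Tendsto (polarLine a e) (𝓝 0) (𝓝 (a, star a)) := by
  have : Continuous (polarLine a e) := by unfold polarLine; fun_prop
  exact this.tendsto' 0 _ (polarLine_zero a e)

theorem analyticAt_polarLine (a e : CSpace m) (p : ℂ × ℂ) : AnalyticAt ℂ (polarLine a e) p := by
  unfold polarLine
  exact (analyticAt_const.add (analyticAt_fst.smul analyticAt_const)).prod
    (analyticAt_const.add (analyticAt_snd.smul analyticAt_const))

theorem AnalyticAt.comp_polarLine {T : CSpace m × CSpace m → ℂ} {a : CSpace m} (e : CSpace m)
    (hT : AnalyticAt ℂ T (a, star a)) : AnalyticAt ℂ (fun p => T (polarLine a e p)) 0 :=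
  AnalyticAt.fun_comp (g := T) (by rwa [polarLine_zero]) (analyticAt_polarLine a e 0)

theorem fderiv_comp_polarLine {T : CSpace m × CSpace m → ℂ} {a e : CSpace m} {p : ℂ × ℂ}
    (hT : AnalyticAt ℂ T (polarLine a e p)) (v : ℂ × ℂ) :
    fderiv ℂ (fun p => T (polarLine a e p)) p v =
      fderiv ℂ T (polarLine a e p) (v.1 • e, v.2 • e) := by
  have hL : HasFDerivAt (polarLine a e)
      (((ContinuousLinearMap.fst ℂ ℂ ℂ).smulRight e).prod
        ((ContinuousLinearMap.snd ℂ ℂ ℂ).smulRight e)) p := by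
    unfold polarLine
    exact ((hasFDerivAt_fst.smul_const e).const_add a).prodMk
      ((hasFDerivAt_snd.smul_const e).const_add (star a))
  refine (DFunLike.congr_fun (hT.differentiableAt.hasFDerivAt.comp p hL).fderiv v).trans ?_
  simp

theorem fderiv_comp_polarLine_add {T : CSpace m × CSpace m → ℂ} {a e d₁ d₂ : CSpace m}
    {q : (ℂ × ℂ) × ℂ} (hT : AnalyticAt ℂ T (polarLine a e q.1 + q.2 • (d₁, d₂))) :
    fderiv ℂ (fun q : (ℂ × ℂ) × ℂ => T (polarLine a e q.1 + q.2 • (d₁, d₂))) q (0, 1) =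
      fderiv ℂ T (polarLine a e q.1 + q.2 • (d₁, d₂)) (d₁, d₂) := by
  have hL : HasFDerivAt (fun q : (ℂ × ℂ) × ℂ => polarLine a e q.1 + q.2 • (d₁, d₂))
      ((fderiv ℂ (polarLine a e) q.1).comp (ContinuousLinearMap.fst ℂ (ℂ × ℂ) ℂ) +
        (ContinuousLinearMap.snd ℂ (ℂ × ℂ) ℂ).smulRight (d₁, d₂)) q :=
    (HasFDerivAt.comp (f := Prod.fst) q (analyticAt_polarLine a e q.1).differentiableAt.hasFDerivAt
      hasFDerivAt_fst).add (hasFDerivAt_snd.smul_const (d₁, d₂))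
  refine (DFunLike.congr_fun (HasFDerivAt.fderiv (HasFDerivAt.comp
    (f := fun q : (ℂ × ℂ) × ℂ => polarLine a e q.1 + q.2 • (d₁, d₂)) q
    hT.differentiableAt.hasFDerivAt hL)) (0, 1)).trans ?_
  simp

theorem polarLine_add_zero_smul (a e d₁ d₂ : CSpace m) (p : ℂ × ℂ) :
    polarLine a e p + (0 : ℂ) • (d₁, d₂) = polarLine a e p := by
  rw [zero_smul, add_zero]

/-- The complex extension of a function in the class `𝓕`, and its first two derivatives in a fixed
direction, are along a polarized line algebraic over functions with separated variables. -/
theorem IsComplexExtensionAt.isSepAlgebraic {u : CSpace m → ℝ} {T : CSpace m × CSpace m → ℂ}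
    {a : CSpace m} (hT : IsComplexExtensionAt u T a) (hu : u ∈ NashClass m a) (e d₁ d₂ : CSpace m) :
    IsSepAlgebraic (fun p => T (polarLine a e p)) ∧
    IsSepAlgebraic (fun p => fderiv ℂ T (polarLine a e p) (d₁, d₂)) ∧
    IsSepAlgebraic (fun p =>
      fderiv ℂ (fun q => fderiv ℂ T q (d₁, d₂)) (polarLine a e p) (d₁, d₂)) := by
  obtain ⟨k, V, ξ, f, -, ⟨hV, Ω, G, -, hΩ, hG, hGξ⟩, hf, haV, hu⟩ := hu
  obtain ⟨hGa, P, hP, hPG⟩ := hG _ (hΩ _ haV)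
  have hfs : ∀ i, AnalyticAt ℂ (fun w => star (f i (star w))) (star a) := fun i => (hf i).star_star
  have hfv : AnalyticAt ℂ (fun z i => f i z) a := AnalyticAt.pi hf
  have hfsv : AnalyticAt ℂ (fun w i => star (f i (star w))) (star a) := AnalyticAt.pi hfs
  have ha0 : (fun i => star (f i (star (star a)))) = star (fun i => f i a) := by
    rw [star_star]; rfl
  -- polarization identifies `T` with the extension given by the Nash function
  have hTG : ∀ᶠ p in 𝓝 (a, star a), T p = G (fun i => f i p.1, fun i => star (f i (star p.2))) := by
    have hGc : AnalyticAt ℂ (fun p : CSpace m × CSpace m =>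
        G (fun i => f i p.1, fun i => star (f i (star p.2)))) (a, star a) :=
      analyticAt_comp_prodMap (T := G) (w := (a, star a)) (α := fun z i => f i z)
        (β := fun w i => star (f i (star w))) (by rw [ha0]; exact hGa) hfv hfsv
    have := (hT.1.sub hGc).eventually_eq_zero_of_star ?_
    · filter_upwards [this] with p hp using sub_eq_zero.mp hp
    · filter_upwards [hT.2, hu, hfv.continuousAt.eventually_mem (hV.mem_nhds haV)] with z h1 h2 h3
      have h4 : (fun i => star (f i (star (star z)))) = star (fun i => f i z) := by
        rw [star_star]; rfl
      change T (z, star z) - G (fun i => f i z, fun i => star (f i (star (star z)))) = 0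
      rw [h1, h2, h4, hGξ _ h3, sub_self]
  let x : Fin k ⊕ Fin k → (ℂ × ℂ) × ℂ → ℂ := Sum.elim
    (fun i q => f i (a + q.1.1 • e + q.2 • d₁))
    (fun i q => star (f i (star (star a + q.1.2 • e + q.2 • d₂))))
  have hx : ∀ i, ∃ (l : ℂ × ℂ →L[ℂ] ℂ) (b : ℂ × ℂ → ℂ), AnalyticAt ℂ b 0 ∧
      (l = ContinuousLinearMap.fst ℂ ℂ ℂ ∨ l = ContinuousLinearMap.snd ℂ ℂ ℂ) ∧
      ∀ p, x i p = b (l p.1, p.2) := by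
    have hlin : ∀ b d : CSpace m, AnalyticAt ℂ (fun p : ℂ × ℂ => b + p.1 • e + p.2 • d) 0 :=
      fun b d => (analyticAt_const.add (analyticAt_fst.smul analyticAt_const)).add
        (analyticAt_snd.smul analyticAt_const)
    rintro (i | i)
    · exact ⟨_, fun p => f i (a + p.1 • e + p.2 • d₁),
        AnalyticAt.fun_comp (g := f i) (by simpa using hf i) (hlin a d₁), Or.inl rfl, fun p => rfl⟩
    · exact ⟨_, fun p => star (f i (star (star a + p.1 • e + p.2 • d₂))),
        AnalyticAt.fun_comp (g := fun w => star (f i (star w))) (by simpa using hfs i)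
          (hlin (star a) d₂), Or.inr rfl, fun p => rfl⟩
  have hx0 : (fun i => x i 0) = Sum.elim (fun i => f i a) (star fun i => f i a) := by
    funext i
    rcases i with i | i <;> simp [x]
  have hsplit : AnalyticAt ℂ (fun v : Fin k ⊕ Fin k → ℂ => (v ∘ Sum.inl, v ∘ Sum.inr))
      (fun i => x i 0) :=
    (AnalyticAt.pi fun i => (ContinuousLinearMap.proj (R := ℂ) (φ := fun _ => ℂ)
      (Sum.inl i : Fin k ⊕ Fin k)).analyticAt _).prod
      (AnalyticAt.pi fun i => (ContinuousLinearMap.proj (R := ℂ) (φ := fun _ => ℂ)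
        (Sum.inr i : Fin k ⊕ Fin k)).analyticAt _)
  have hsplit0 : ((fun i => x i 0) ∘ Sum.inl, (fun i => x i 0) ∘ Sum.inr) =
      ((fun i => f i a : CSpace k), (star fun i => f i a : CSpace k)) := by
    rw [hx0, Sum.elim_comp_inl, Sum.elim_comp_inr]
  obtain ⟨hHa, h0, h1, h2⟩ := isSepAlgebraic_nash hx
    (G := fun v => G (v ∘ Sum.inl, v ∘ Sum.inr)) (P := P)
    (AnalyticAt.fun_comp (g := G) (by rw [hsplit0]; exact hGa) hsplit) hP
    (by
      have := hsplit.continuousAt.tendsto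
      rw [hsplit0] at this
      filter_upwards [this.eventually hPG] with v hv
      simpa [Sum.elim_comp_inl_inr] using hv)
    (H := fun q => G (fun i => x (Sum.inl i) q, fun i => x (Sum.inr i) q)) (fun _ => rfl)
  have hcont : Filter.Tendsto (fun q : (ℂ × ℂ) × ℂ => polarLine a e q.1 + q.2 • (d₁, d₂)) (𝓝 0)
      (𝓝 (a, star a)) := by
    have : Continuous (fun q : (ℂ × ℂ) × ℂ => polarLine a e q.1 + q.2 • (d₁, d₂)) := by
      unfold polarLine; fun_prop
    exact this.tendsto' 0 _ (by simp [polarLine_zero])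
  have hin : Filter.Tendsto (fun p : ℂ × ℂ => (p, (0 : ℂ))) (𝓝 0) (𝓝 0) :=
    (Continuous.prodMk_left (0 : ℂ)).tendsto' 0 0 rfl
  have hHT : (fun q => G (fun i => x (Sum.inl i) q, fun i => x (Sum.inr i) q)) =ᶠ[𝓝 0]
      fun q => T (polarLine a e q.1 + q.2 • (d₁, d₂)) := by
    filter_upwards [hcont.eventually hTG] with q hq
    rw [hq]
    rfl
  have hd1 : (fun q' => fderiv ℂ (fun q => G (fun i => x (Sum.inl i) q, fun i => x (Sum.inr i) q))
      q' (0, 1)) =ᶠ[𝓝 0] fun q => fderiv ℂ T (polarLine a e q.1 + q.2 • (d₁, d₂)) (d₁, d₂) := by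
    filter_upwards [hHT.fderiv (𝕜 := ℂ), hcont.eventually hT.1.eventually_analyticAt] with q h3 h4
    rw [h3, fderiv_comp_polarLine_add h4]
  have hd2 : (fun q'' => fderiv ℂ (fun q' => fderiv ℂ
      (fun q => G (fun i => x (Sum.inl i) q, fun i => x (Sum.inr i) q)) q' (0, 1)) q'' (0, 1))
      =ᶠ[𝓝 0] fun q => fderiv ℂ (fun q => fderiv ℂ T q (d₁, d₂))
        (polarLine a e q.1 + q.2 • (d₁, d₂)) (d₁, d₂) := by
    filter_upwards [hd1.fderiv (𝕜 := ℂ), hcont.eventually hT.1.eventually_analyticAt] with q h3 h4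
    rw [h3, fderiv_comp_polarLine_add (T := fun q => fderiv ℂ T q (d₁, d₂)) (h4.fderiv_apply _)]
  refine ⟨h0.congr ?_, h1.congr ?_, h2.congr ?_⟩
  · filter_upwards [hin.eventually hHT] with p hp
    rw [hp, polarLine_add_zero_smul]
  · filter_upwards [hin.eventually hd1] with p hp
    rw [hp, polarLine_add_zero_smul]
  · filter_upwards [hin.eventually hd2] with p hp
    rw [hp, polarLine_add_zero_smul]

/-- Polarization of the second derivative as a quadratic form. -/
theorem mixedHessian_eq_polarization {E : Type*} [NormedAddCommGroup E] [NormedSpace ℂ E]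
    {T : E × E → ℂ} {p : E × E} (hT : AnalyticAt ℂ T p) (x y : E) :
    mixedHessian T p x y =
      (1 / 2) * (fderiv ℂ (fun q => fderiv ℂ T q (x, y)) p (x, y) +
        (-1) * (fderiv ℂ (fun q => fderiv ℂ T q (x, 0)) p (x, 0) +
          fderiv ℂ (fun q => fderiv ℂ T q (0, y)) p (0, y))) := by
  have hsymm : IsSymmSndFDerivAt ℂ T p :=
    (hT.contDiffAt (n := ω)).isSymmSndFDerivAt (by simp)
  have hxy : ((x, y) : E × E) = (x, 0) + (0, y) := by simp
  rw [mixedHessian_eq hT, fderiv_fderiv_apply hT, fderiv_fderiv_apply hT, fderiv_fderiv_apply hT,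
    hxy, map_add]
  simp only [add_apply, map_add]
  rw [hsymm.eq (0, y) (x, 0)]
  ring

theorem IsComplexExtensionAt.isSepAlgebraic_mixedHessian {u : CSpace m → ℝ}
    {T : CSpace m × CSpace m → ℂ} {a : CSpace m} (hT : IsComplexExtensionAt u T a)
    (hu : u ∈ NashClass m a) (e x y : CSpace m) :
    IsSepAlgebraic (fun p => mixedHessian T (polarLine a e p) x y) := by
  refine IsSepAlgebraic.congr ((IsSepAlgebraic.const (1 / 2)).mul
    ((hT.isSepAlgebraic hu e x y).2.2.add ((IsSepAlgebraic.const (-1)).mul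
      ((hT.isSepAlgebraic hu e x 0).2.2.add (hT.isSepAlgebraic hu e 0 y).2.2)))) ?_
  filter_upwards [(tendsto_polarLine a e).eventually hT.1.eventually_analyticAt] with p hp
  exact (mixedHessian_eq_polarization hp x y).symm

end line

/-! ### Kähler potentials with constant Ricci curvature -/

section core

variable {m : ℕ}

theorem analyticAt_det {E : Type*} [NormedAddCommGroup E] [NormedSpace ℂ E]
    {f : Fin m → Fin m → E → ℂ} {p : E} (hf : ∀ i j, AnalyticAt ℂ (f i j) p) :
    AnalyticAt ℂ (fun p => (Matrix.of fun i j => f i j p).det) p := by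
  simp only [Matrix.det_apply', Matrix.of_apply]
  exact Finset.analyticAt_fun_sum _ fun σ _ => analyticAt_const.mul
    (Finset.analyticAt_fun_prod _ fun i _ => hf _ _)

/-- If `Ψ` and the `ψ i` are of diastasis-type in the class `𝓕`, `u = Ψ + log ∏ ψ i ^ γ i`, and
`∂∂̄ log det ∂∂̄u + c ∂∂̄u` vanishes in the direction of one of the coordinates, in which `∂∂̄Ψ` does
not vanish, then `c = 0`. -/
theorem eq_zero_of_complexHessian_log_det {r : ℕ} {a : CSpace m} {Ψ : CSpace m → ℝ}
    {ψ : Fin r → CSpace m → ℝ} {γ : Fin r → ℝ} (hΨ : Ψ ∈ NashDiastasisClass m a)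
    (hψ : ∀ i, ψ i ∈ NashDiastasisClass m a) (hψpos : ∀ i, ∀ᶠ z in 𝓝 a, 0 < ψ i z)
    {u v : CSpace m → ℝ} (hu : ∀ᶠ z in 𝓝 a, u z = Ψ z + Real.log (∏ i, ψ i z ^ γ i))
    (hdet : ∀ᶠ z in 𝓝 a, 0 < (complexHessian u z).det.re ∧ (complexHessian u z).det.im = 0)
    (hv : ∀ᶠ z in 𝓝 a, v z = Real.log (complexHessian u z).det.re) {c : ℝ} (j : Fin m)
    (hKE : ∀ᶠ z in 𝓝 a, complexHessian v z j j + c * complexHessian u z j j = 0)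
    (hne : complexHessian Ψ a j j ≠ 0) : c = 0 := by
  obtain ⟨hΨN, T, hT, hTz, -⟩ := hΨ
  choose hψN S hS hSz hSw using hψ
  have hψa : ∀ i, 0 < ψ i a := fun i => (hψpos i).self_of_nhds
  have hSa : ∀ i, S i (a, star a) = ψ i a := fun i => (hS i).2.self_of_nhds
  have hSslit : ∀ i, S i (a, star a) ∈ Complex.slitPlane := fun i => by
    rw [hSa]; exact Complex.ofReal_mem_slitPlane.mpr (hψa i)
  have hSslit' : ∀ᶠ p in 𝓝 (a, star a), ∀ i, S i p ∈ Complex.slitPlane :=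
    Filter.eventually_all.mpr fun i => (hS i).1.continuousAt.eventually_mem
      (Complex.isOpen_slitPlane.mem_nhds (hSslit i))
  have hSan : ∀ᶠ p in 𝓝 (a, star a), ∀ i, AnalyticAt ℂ (S i) p :=
    Filter.eventually_all.mpr fun i => (hS i).1.eventually_analyticAt
  -- the complex extension of `u`
  let B : CSpace m × CSpace m → ℂ := fun p => T p + ∑ i, (γ i : ℂ) * Complex.log (S i p)
  have hB : IsComplexExtensionAt u B a := by
    refine ⟨hT.1.add (Finset.analyticAt_fun_sum _ fun i _ =>
      analyticAt_const.mul ((hS i).1.clog (hSslit i))), ?_⟩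
    filter_upwards [hT.2, Filter.eventually_all.mpr fun i => (hS i).2,
      Filter.eventually_all.mpr hψpos, hu] with z h1 h2 h3 h4
    rw [h4, Real.log_prod fun i _ => (Real.rpow_pos_of_pos (h3 i) _).ne']
    simp only [B, h1, h2]
    push_cast
    congr 1
    refine Finset.sum_congr rfl fun i _ => ?_
    rw [Real.log_rpow (h3 i), ← Complex.ofReal_log (h3 i).le, Complex.ofReal_mul]
  -- the complex extension of the determinant of the metric
  let Δ : CSpace m × CSpace m → ℂ := fun p =>
    (Matrix.of fun i k => mixedHessian B p (Pi.single i 1) (Pi.single k 1)).det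
  have hΔan : AnalyticAt ℂ Δ (a, star a) := analyticAt_det fun i k => hB.1.mixedHessian _ _
  have hΔdiag : ∀ᶠ z in 𝓝 a, Δ (z, star z) = (complexHessian u z).det := by
    filter_upwards [hB.eventually] with z hz
    simp only [Δ]
    congr 1
    ext i k
    exact (hz.complexHessian_apply i k).symm
  have hΔpos : ∀ᶠ z in 𝓝 a, 0 < (complexHessian u z).det.re ∧
      Δ (z, star z) = ((complexHessian u z).det.re : ℂ) := by
    filter_upwards [hΔdiag, hdet] with z h1 h2
    refine ⟨h2.1, h1.trans (Complex.ext (by simp) (by simp [h2.2]))⟩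
  have hΔslit : Δ (a, star a) ∈ Complex.slitPlane := by
    obtain ⟨h1, h2⟩ := hΔpos.self_of_nhds
    rw [h2]
    exact Complex.ofReal_mem_slitPlane.mpr h1
  have hΔslit' : ∀ᶠ p in 𝓝 (a, star a), Δ p ∈ Complex.slitPlane :=
    hΔan.continuousAt.eventually_mem (Complex.isOpen_slitPlane.mem_nhds hΔslit)
  let Λ : CSpace m × CSpace m → ℂ := fun p => Complex.log (Δ p)
  have hΛ : IsComplexExtensionAt v Λ a := by
    refine ⟨hΔan.clog hΔslit, ?_⟩
    filter_upwards [hΔpos, hv] with z h1 h2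
    simp only [Λ]
    rw [h1.2, h2, Complex.ofReal_log h1.1.le]
  -- the Einstein equation, polarized
  let Y : CSpace m × CSpace m → ℂ := fun p => Λ p + ∑ _i : Unit, (c : ℂ) * B p
  have hY : AnalyticAt ℂ Y (a, star a) :=
    hΛ.1.add (Finset.analyticAt_fun_sum _ fun _ _ => analyticAt_const.mul hB.1)
  let e : CSpace m := Pi.single j 1
  have hYmixed : ∀ᶠ p in 𝓝 (a, star a), mixedHessian Y p e e = 0 := by
    refine (hY.mixedHessian e e).eventually_eq_zero_of_star ?_
    filter_upwards [hKE, hΛ.eventually, hB.eventually] with z h1 h2 h3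
    rw [h2.complexHessian_apply, h3.complexHessian_apply] at h1
    refine (mixedHessian_add_sum (fun _ => (c : ℂ)) h2.1 (fun _ => h3.1) e e).trans ?_
    simpa using h1
  have hline := tendsto_polarLine a e
  by_contra hc
  have hc' : (c : ℂ) ≠ 0 := by exact_mod_cast hc
  let G : ℂ × ℂ → ℂ := fun p => fderiv ℂ Y (polarLine a e p) (0, e)
  have hG : AnalyticAt ℂ G 0 := (hY.fderiv_apply (0, e)).comp_polarLine e
  have hG' : ∀ᶠ p in 𝓝 (0 : ℂ × ℂ), fderiv ℂ G p (1, 0) = 0 := by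
    filter_upwards [hline.eventually hYmixed, hline.eventually hY.eventually_analyticAt] with p h1 h2
    rw [fderiv_comp_polarLine (T := fun q => fderiv ℂ Y q (0, e)) (h2.fderiv_apply _)]
    simpa [mixedHessian] using h1
  have hGs := hG.eventually_eq_of_fderiv_fst_eq_zero hG'
  have hZ : AnalyticAt ℂ (fun s : ℂ => (c : ℂ)⁻¹ * G (0, s)) 0 :=
    analyticAt_const.mul (AnalyticAt.fun_comp (g := G) (f := fun s : ℂ => ((0 : ℂ), s)) hG
      (analyticAt_const.prod analyticAt_id))
  -- algebraicity of the functions involved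
  have hTK : IsSepAlgebraic (fun p => T (polarLine a e p)) := (hT.isSepAlgebraic hΨN e 0 0).1
  have hSK : ∀ i, IsSepAlgebraic (fun p => S i (polarLine a e p)) := fun i =>
    ((hS i).isSepAlgebraic (hψN i) e 0 0).1
  have hSK0 : ∀ i, S i (polarLine a e 0) ≠ 0 := fun i => by
    rw [polarLine_zero]; exact Complex.slitPlane_ne_zero (hSslit i)
  have hBK : ∀ i k : Fin m, IsSepAlgebraic (fun p =>
      mixedHessian B (polarLine a e p) (Pi.single i 1) (Pi.single k 1)) := by
    intro i k
    refine IsSepAlgebraic.congr ((hT.isSepAlgebraic_mixedHessian hΨN e (Pi.single i 1)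
      (Pi.single k 1)).add (IsSepAlgebraic.sum Finset.univ fun l _ =>
        (IsSepAlgebraic.const (γ l)).mul ((((hS l).isSepAlgebraic_mixedHessian (hψN l) e
          (Pi.single i 1) (Pi.single k 1)).mul ((hSK l).inv (hSK0 l))).add
            ((IsSepAlgebraic.const (-1)).mul
              ((((hS l).isSepAlgebraic (hψN l) e (Pi.single i 1) 0).2.1.mul
                ((hS l).isSepAlgebraic (hψN l) e 0 (Pi.single k 1)).2.1).mul
                  (((hSK l).inv (hSK0 l)).mul ((hSK l).inv (hSK0 l)))))))) ?_
    filter_upwards [hline.eventually hT.1.eventually_analyticAt, hline.eventually hSan,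
      hline.eventually hSslit'] with p h1 h2 h3
    refine Eq.trans ?_ (mixedHessian_add_sum (fun l => (γ l : ℂ)) h1
      (fun l => (h2 l).clog (h3 l)) (Pi.single i 1) (Pi.single k 1)).symm
    congr 1
    refine Finset.sum_congr rfl fun l _ => ?_
    rw [mixedHessian_clog (h2 l) (h3 l)]
  have hΔK : IsSepAlgebraic (fun p => Δ (polarLine a e p)) := IsSepAlgebraic.det hBK
  let A : Option (Fin r) → ℂ × ℂ → ℂ := fun o p =>
    o.elim (Δ (polarLine a e p)) fun i => S i (polarLine a e p)
  have key := IsSepAlgebraic.fderiv_fderiv_eq_zero (A := A)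
    (fun o => o.elim (-(c : ℂ)⁻¹) fun i => -(γ i : ℂ)) hTK
    (by rintro (_ | i); exacts [hΔK, hSK i])
    (by
      rintro (_ | i)
      · change Δ (polarLine a e 0) ≠ 0
        rw [polarLine_zero]; exact Complex.slitPlane_ne_zero hΔslit
      · exact hSK0 i)
    ?_ hZ ?_
  · have h1 : (fun p => fderiv ℂ (fun p => T (polarLine a e p)) p (0, 1)) =ᶠ[𝓝 0]
        fun p => fderiv ℂ T (polarLine a e p) (0, e) := by
      filter_upwards [hline.eventually hT.1.eventually_analyticAt] with p hp
      rw [fderiv_comp_polarLine hp]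
      simp
    rw [h1.fderiv_eq, fderiv_comp_polarLine (T := fun q => fderiv ℂ T q (0, e))
      (by rw [polarLine_zero]; exact hT.1.fderiv_apply _), polarLine_zero, one_smul, zero_smul]
      at key
    exact hne ((hT.complexHessian_apply j j).trans key)
  · have : Filter.Tendsto (fun t : ℂ => a + t • e) (𝓝 0) (𝓝 a) :=
      (show Continuous fun t : ℂ => a + t • e by fun_prop).tendsto' 0 a (by simp)
    filter_upwards [this.eventually hTz] with t ht
    simpa [polarLine] using ht
  · filter_upwards [hGs, hline.eventually hT.1.eventually_analyticAt, hline.eventually hSan,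
      hline.eventually hSslit', hline.eventually hΔan.eventually_analyticAt,
      hline.eventually hΔslit', hline.eventually hB.1.eventually_analyticAt]
      with p h0 h1 h2 h3 h4 h5 h6
    have e1 : G p = fderiv ℂ Δ (polarLine a e p) (0, e) * (Δ (polarLine a e p))⁻¹ +
        c * (fderiv ℂ T (polarLine a e p) (0, e) + ∑ i, (γ i : ℂ) *
          (fderiv ℂ (S i) (polarLine a e p) (0, e) * (S i (polarLine a e p))⁻¹)) := by
      refine (fderiv_add_sum (fun _ : Unit => (c : ℂ)) (h4.clog h5) (fun _ => h6) (0, e)).trans ?_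
      rw [fderiv_clog h4 h5]
      simp only [Finset.univ_unique, Finset.sum_const, Finset.card_singleton, one_smul]
      congr 2
      refine (fderiv_add_sum (fun l => (γ l : ℂ)) h1 (fun l => (h2 l).clog (h3 l)) (0, e)).trans ?_
      congr 1
      refine Finset.sum_congr rfl fun l _ => ?_
      rw [fderiv_clog (h2 l) (h3 l)]
    have e2 : ∀ (K : CSpace m × CSpace m → ℂ), AnalyticAt ℂ K (polarLine a e p) →
        fderiv ℂ (fun p => K (polarLine a e p)) p (0, 1) = fderiv ℂ K (polarLine a e p) (0, e) := by
      intro K hK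
      rw [fderiv_comp_polarLine hK]
      simp
    rw [← h0, e1, Fintype.sum_option, e2 T h1]
    simp only [A, Option.elim_none, Option.elim_some]
    rw [e2 Δ h4]
    simp only [fun i => e2 (S i) (h2 i)]
    rw [mul_add, inv_mul_cancel_left₀ hc']
    simp only [neg_mul, Finset.sum_neg_distrib]
    ring

end core

/-! ### Holomorphic substitutions -/

section substitution

variable {m n : ℕ}

theorem IsComplexExtensionAt.comp {u : CSpace n → ℝ} {T : CSpace n × CSpace n → ℂ}
    {F : CSpace m → CSpace n} {w : CSpace m} (hT : IsComplexExtensionAt u T (F w))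
    (hF : AnalyticAt ℂ F w) :
    IsComplexExtensionAt (fun w => u (F w)) (fun p => T (F p.1, star (F (star p.2)))) w := by
  refine ⟨analyticAt_comp_prodMap (T := T) (α := F) (β := fun v => star (F (star v)))
    (w := (w, star w)) (by rw [star_star]; exact hT.1) hF hF.star_star, ?_⟩
  filter_upwards [hF.continuousAt.eventually hT.2] with z hz
  rw [star_star, hz]

theorem NashClass.comp {u : CSpace n → ℝ} {F : CSpace m → CSpace n} {w : CSpace m}
    (hu : u ∈ NashClass n (F w)) (hF : AnalyticAt ℂ F w) :
    (fun w => u (F w)) ∈ NashClass m w := by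
  obtain ⟨k, V, ξ, f, hk, hξ, hf, hV, h⟩ := hu
  exact ⟨k, V, ξ, fun i w => f i (F w), hk, hξ, fun i => (hf i).fun_comp hF, hV,
    hF.continuousAt.eventually h⟩

/-- The class `𝓕̃` is stable under holomorphic substitutions. -/
theorem NashDiastasisClass.comp {u : CSpace n → ℝ} {F : CSpace m → CSpace n} {w : CSpace m}
    (hu : u ∈ NashDiastasisClass n (F w)) (hF : AnalyticAt ℂ F w) :
    (fun w => u (F w)) ∈ NashDiastasisClass m w := by
  obtain ⟨hN, T, hT, h1, h2⟩ := hu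
  refine ⟨NashClass.comp hN hF, _, hT.comp hF, ?_, ?_⟩
  · simp only [star_star]
    exact hF.continuousAt.eventually h1
  · simp only [star_star]
    have := hF.star_star.continuousAt.tendsto
    rw [star_star] at this
    exact this.eventually h2

theorem fderiv_star_star {F : CSpace m → CSpace n} {w : CSpace m} (hF : AnalyticAt ℂ F w)
    (v : CSpace m) :
    fderiv ℂ (fun v => star (F (star v))) (star w) v = star (fderiv ℂ F w (star v)) :=
  DFunLike.congr_fun hF.differentiableAt.hasFDerivAt.star_star.fderiv v

theorem CSpace.eq_sum_single (x : CSpace n) : x = ∑ l, x l • (Pi.single l 1 : CSpace n) := by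
  conv_lhs => rw [← (Pi.basisFun ℂ (Fin n)).sum_repr x]
  simp

theorem mixedHessian_eq_sum {T : CSpace n × CSpace n → ℂ} {p : CSpace n × CSpace n}
    (hT : AnalyticAt ℂ T p) (x y : CSpace n) :
    mixedHessian T p x y =
      ∑ l, ∑ i, mixedHessian T p (Pi.single l 1) (Pi.single i 1) * x l * y i := by
  have hx : ((x, 0) : CSpace n × CSpace n) = ∑ l, x l • (Pi.single l 1, 0) := by
    conv_lhs => rw [CSpace.eq_sum_single x]
    simp [Prod.ext_iff, Prod.fst_sum, Prod.snd_sum]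
  have hy : ((0, y) : CSpace n × CSpace n) = ∑ l, y l • (0, Pi.single l 1) := by
    conv_lhs => rw [CSpace.eq_sum_single y]
    simp [Prod.ext_iff, Prod.fst_sum, Prod.snd_sum]
  simp only [mixedHessian_eq hT]
  rw [hx, hy]
  simp only [map_sum, map_smul, sum_apply, smul_apply, smul_eq_mul, Finset.mul_sum]
  rw [Finset.sum_comm]
  refine Finset.sum_congr rfl fun l _ => Finset.sum_congr rfl fun i _ => ?_
  ring

/-- The complex Hessian of a holomorphic pullback is the pullback of the Levi form. -/
theorem IsComplexExtensionAt.complexHessian_comp {u : CSpace n → ℝ}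
    {T : CSpace n × CSpace n → ℂ} {F : CSpace m → CSpace n} {w : CSpace m}
    (hT : IsComplexExtensionAt u T (F w)) (hF : AnalyticAt ℂ F w) (j k : Fin m) :
    complexHessian (fun w => u (F w)) w j k =
      ∑ l, ∑ i, complexHessian u (F w) l i * fderiv ℂ F w (Pi.single j 1) l *
        star (fderiv ℂ F w (Pi.single k 1) i) := by
  have h1 := mixedHessian_comp_prodMap (T := T) (α := F) (β := fun v => star (F (star v)))
    (w := (w, star w)) (by rw [star_star]; exact hT.1) hF hF.star_star
    (Pi.single j 1) (Pi.single k 1)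
  rw [(hT.comp hF).complexHessian_apply, h1]
  simp only [star_star]
  rw [mixedHessian_eq_sum hT.1, fderiv_star_star hF]
  have hk : star (Pi.single k (1 : ℂ) : CSpace m) = Pi.single k 1 := by
    rw [← Pi.single_star, star_one]
  rw [hk]
  simp only [hT.complexHessian_apply]
  rfl

/-- Adding functions of `z` alone and of `w` alone does not change the mixed second derivative. -/
theorem mixedHessian_add_separated {T : CSpace n × CSpace n → ℂ} {P Q : CSpace n → ℂ}
    {p : CSpace n × CSpace n} (hT : AnalyticAt ℂ T p) (hP : AnalyticAt ℂ P p.1)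
    (hQ : AnalyticAt ℂ Q p.2) (x y : CSpace n) :
    mixedHessian (fun p => T p + (P p.1 + Q p.2)) p x y = mixedHessian T p x y := by
  have h1 : (fun p' => fderiv ℂ (fun p => T p + (P p.1 + Q p.2)) p' (0, y)) =ᶠ[𝓝 p]
      fun p' => fderiv ℂ T p' (0, y) + fderiv ℂ Q p'.2 y := by
    filter_upwards [hT.eventually_analyticAt, continuousAt_fst.eventually hP.eventually_analyticAt,
      continuousAt_snd.eventually hQ.eventually_analyticAt] with p' a1 a2 a3
    have d2 := HasFDerivAt.comp (f := Prod.fst) p' a2.differentiableAt.hasFDerivAt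
      (hasFDerivAt_fst (𝕜 := ℂ) (E := CSpace n) (F := CSpace n))
    have d3 := HasFDerivAt.comp (f := Prod.snd) p' a3.differentiableAt.hasFDerivAt
      (hasFDerivAt_snd (𝕜 := ℂ) (E := CSpace n) (F := CSpace n))
    refine (DFunLike.congr_fun (a1.differentiableAt.hasFDerivAt.add (d2.add d3)).fderiv _).trans ?_
    simp
  have d3 := HasFDerivAt.comp (f := Prod.snd) p (hQ.fderiv_apply y).differentiableAt.hasFDerivAt
      (hasFDerivAt_snd (𝕜 := ℂ) (E := CSpace n) (F := CSpace n))
  unfold mixedHessian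
  rw [h1.fderiv_eq]
  refine (DFunLike.congr_fun
    ((hT.fderiv_apply (0, y)).differentiableAt.hasFDerivAt.add d3).fderiv _).trans ?_
  simp

end substitution

/-! ### Kähler metrics in coordinates -/

section kahler

variable {n : ℕ} {N : Type*} [TopologicalSpace N] [ChartedSpace (CSpace n) N]

/-- The diastasis function is itself a potential of the metric: it differs from any other potential
by the sum of a holomorphic and an antiholomorphic function. -/
theorem KahlerMetric.IsDiastasisAt.exists_extension {h : KahlerMetric n N} {q : N}
    {φ : OpenPartialHomeomorph N (CSpace n)} {D : CSpace n → ℝ} (hD : h.IsDiastasisAt q φ D) :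
    ∃ T, IsComplexExtensionAt D T (φ q) ∧
      ∀ᶠ z in 𝓝 (φ q), h.form.matrix φ z = complexHessian D z := by
  obtain ⟨u, T, hu, hT, hDT⟩ := hD
  have hP : AnalyticAt ℂ (fun z => T (φ q, star (φ q)) - T (z, star (φ q))) (φ q) :=
    analyticAt_const.sub (AnalyticAt.fun_comp (g := T) hT.1 (analyticAt_id.prod analyticAt_const))
  have hQ : AnalyticAt ℂ (fun w => -T (φ q, w)) (star (φ q)) :=
    (AnalyticAt.fun_comp (g := T) hT.1 (analyticAt_const.prod analyticAt_id)).neg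
  have hDx : IsComplexExtensionAt D (fun p => T p + ((T (φ q, star (φ q)) - T (p.1, star (φ q))) +
      -T (φ q, p.2))) (φ q) := by
    refine ⟨hT.1.add ((AnalyticAt.fun_comp (g := fun z => T (φ q, star (φ q)) - T (z, star (φ q)))
      (f := Prod.fst) (x := (φ q, star (φ q))) hP analyticAt_fst).add
      (AnalyticAt.fun_comp (g := fun w => -T (φ q, w)) (f := Prod.snd) (x := (φ q, star (φ q))) hQ
        analyticAt_snd)), ?_⟩
    filter_upwards [hDT] with z hz
    rw [hz]
    ring
  refine ⟨_, hDx, ?_⟩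
  filter_upwards [hu, hT.eventually, hDx.eventually, hP.eventually_analyticAt,
    (continuous_star.tendsto (φ q)).eventually hQ.eventually_analyticAt] with z h1 h2 h3 h4 h5
  rw [h1]
  ext j k
  rw [h2.complexHessian_apply, h3.complexHessian_apply]
  exact (mixedHessian_add_separated h2.1 h4 h5 _ _).symm

theorem mfderiv_symm_injective [IsManifold 𝓘(ℂ, CSpace n) ω N]
    {φ : OpenPartialHomeomorph N (CSpace n)} (hφ : φ ∈ HolomorphicCharts n N) {y : CSpace n}
    (hy : y ∈ φ.target) :
    Function.Injective (mfderiv 𝓘(ℂ, CSpace n) 𝓘(ℂ, CSpace n) φ.symm y) := by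
  have hd : φ.MDifferentiable 𝓘(ℂ, CSpace n) 𝓘(ℂ, CSpace n) :=
    ⟨(contMDiffOn_of_mem_maximalAtlas hφ).mdifferentiableOn (by simp),
      (contMDiffOn_symm_of_mem_maximalAtlas hφ).mdifferentiableOn (by simp)⟩
  exact hd.symm.mfderiv_injective hy

/-- The sesquilinear form of a metric in terms of its matrix in coordinates. -/
theorem KahlerMetric.form_mfderiv_symm (h : KahlerMetric n N)
    (φ : OpenPartialHomeomorph N (CSpace n)) (y : CSpace n) (a b : CSpace n) :
    h.form (φ.symm y) (mfderiv 𝓘(ℂ, CSpace n) 𝓘(ℂ, CSpace n) φ.symm y a)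
      (mfderiv 𝓘(ℂ, CSpace n) 𝓘(ℂ, CSpace n) φ.symm y b) =
      ∑ l, ∑ i, h.form.matrix φ y l i * a l * star (b i) := by
  let A : CSpace n →L[ℂ] CSpace n := mfderiv 𝓘(ℂ, CSpace n) 𝓘(ℂ, CSpace n) φ.symm y
  let H : CSpace n →ₗ[ℂ] CSpace n →ₗ⋆[ℂ] ℂ := h.form (φ.symm y)
  change H (A a) (A b) = ∑ l, ∑ i, H (A (Pi.single l 1)) (A (Pi.single i 1)) * a l * star (b i)
  conv_lhs => rw [CSpace.eq_sum_single a, CSpace.eq_sum_single b]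
  simp only [map_sum, map_smul, LinearMap.sum_apply, LinearMap.smul_apply, smul_eq_mul,
    LinearMap.map_smulₛₗ, Finset.mul_sum]
  rw [Finset.sum_comm]
  refine Finset.sum_congr rfl fun l _ => Finset.sum_congr rfl fun i _ => ?_
  rw [starRingEnd_apply]
  ring

open scoped ComplexOrder in
theorem KahlerMetric.posDef_matrix [IsManifold 𝓘(ℂ, CSpace n) ω N] (h : KahlerMetric n N)
    {φ : OpenPartialHomeomorph N (CSpace n)} (hφ : φ ∈ HolomorphicCharts n N) {y : CSpace n}
    (hy : y ∈ φ.target) : (h.form.matrix φ y).PosDef := by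
  refine Matrix.posDef_iff_dotProduct_mulVec.mpr ⟨?_, fun x hx => ?_⟩
  · ext j k
    exact (h.hermitian _ _ _).symm
  · have h1 : star x ⬝ᵥ ((h.form.matrix φ y).mulVec x) =
        h.form (φ.symm y) (mfderiv 𝓘(ℂ, CSpace n) 𝓘(ℂ, CSpace n) φ.symm y (star x : CSpace n))
          (mfderiv 𝓘(ℂ, CSpace n) 𝓘(ℂ, CSpace n) φ.symm y (star x : CSpace n)) := by
      rw [h.form_mfderiv_symm]
      simp only [dotProduct, Matrix.mulVec, Finset.mul_sum, Pi.star_apply, star_star]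
      refine Finset.sum_congr rfl fun l _ => Finset.sum_congr rfl fun i _ => ?_
      ring
    rw [h1, Complex.pos_iff]
    refine ⟨h.pos _ _ fun h0 => hx ?_, ?_⟩
    · have h2 : mfderiv 𝓘(ℂ, CSpace n) 𝓘(ℂ, CSpace n) φ.symm y (star x : CSpace n) =
          mfderiv 𝓘(ℂ, CSpace n) 𝓘(ℂ, CSpace n) φ.symm y (0 : CSpace n) :=
        h0.trans (map_zero _).symm
      exact star_eq_zero.mp (mfderiv_symm_injective hφ hy h2)
    · exact (Complex.conj_eq_iff_im.mp (h.hermitian _ _ _).symm).symm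

open scoped ComplexOrder in
theorem KahlerMetric.det_matrix_pos [IsManifold 𝓘(ℂ, CSpace n) ω N] (h : KahlerMetric n N)
    {φ : OpenPartialHomeomorph N (CSpace n)} (hφ : φ ∈ HolomorphicCharts n N) {y : CSpace n}
    (hy : y ∈ φ.target) : 0 < (h.form.matrix φ y).det.re ∧ (h.form.matrix φ y).det.im = 0 := by
  have := Complex.pos_iff.mp (h.posDef_matrix hφ hy).det_pos
  exact ⟨this.1, this.2.symm⟩

open scoped ComplexOrder in
theorem KahlerMetric.matrix_diag_ne_zero [IsManifold 𝓘(ℂ, CSpace n) ω N] (h : KahlerMetric n N)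
    {φ : OpenPartialHomeomorph N (CSpace n)} (hφ : φ ∈ HolomorphicCharts n N) {y : CSpace n}
    (hy : y ∈ φ.target) (j : Fin n) : h.form.matrix φ y j j ≠ 0 :=
  (h.posDef_matrix hφ hy).diag_pos.ne'

variable {m : ℕ} {M : Type*} [TopologicalSpace M] [ChartedSpace (CSpace m) M]

/-- A holomorphic map in coordinates is holomorphic. -/
theorem analyticAt_in_charts [IsManifold 𝓘(ℂ, CSpace n) ω N] [IsManifold 𝓘(ℂ, CSpace m) ω M]
    {f : M → N} (hf : ContMDiff 𝓘(ℂ, CSpace m) 𝓘(ℂ, CSpace n) ω f)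
    {χ : OpenPartialHomeomorph M (CSpace m)} (hχ : χ ∈ HolomorphicCharts m M)
    {φ : OpenPartialHomeomorph N (CSpace n)} (hφ : φ ∈ HolomorphicCharts n N) {w : CSpace m}
    (hw : w ∈ χ.target) (hfw : f (χ.symm w) ∈ φ.source) :
    AnalyticAt ℂ (fun w => φ (f (χ.symm w))) w := by
  have h1 : ContMDiffAt 𝓘(ℂ, CSpace m) 𝓘(ℂ, CSpace n) ω (fun w => φ (f (χ.symm w))) w :=
    (contMDiffAt_of_mem_maximalAtlas hφ hfw).comp w
      ((hf.contMDiffAt (x := χ.symm w)).comp w (contMDiffAt_symm_of_mem_maximalAtlas hχ hw))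
  exact h1.contDiffAt.analyticAt

/-- The matrix of the metric induced by a holomorphic isometry, in coordinates. -/
theorem IsHolomorphicIsometry.matrix_eq [IsManifold 𝓘(ℂ, CSpace n) ω N]
    [IsManifold 𝓘(ℂ, CSpace m) ω M] {g : KahlerMetric m M} {h : KahlerMetric n N} {f : M → N}
    (hf : IsHolomorphicIsometry g h f)
    {χ : OpenPartialHomeomorph M (CSpace m)} (hχ : χ ∈ HolomorphicCharts m M)
    {φ : OpenPartialHomeomorph N (CSpace n)} (hφ : φ ∈ HolomorphicCharts n N) {w : CSpace m}
    (hw : w ∈ χ.target) (hfw : f (χ.symm w) ∈ φ.source) (j k : Fin m) :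
    g.form.matrix χ w j k = ∑ l, ∑ i, h.form.matrix φ (φ (f (χ.symm w))) l i *
      fderiv ℂ (fun w => φ (f (χ.symm w))) w (Pi.single j 1) l *
        star (fderiv ℂ (fun w => φ (f (χ.symm w))) w (Pi.single k 1) i) := by
  let F : CSpace m → CSpace n := fun w => φ (f (χ.symm w))
  have hF : AnalyticAt ℂ F w := analyticAt_in_charts hf.1 hχ hφ hw hfw
  have hχd : MDifferentiableAt 𝓘(ℂ, CSpace m) 𝓘(ℂ, CSpace m) χ.symm w :=
    (contMDiffAt_symm_of_mem_maximalAtlas hχ hw).mdifferentiableAt (by simp)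
  have hfd : MDifferentiableAt 𝓘(ℂ, CSpace m) 𝓘(ℂ, CSpace n) f (χ.symm w) :=
    (hf.1.contMDiffAt (x := χ.symm w)).mdifferentiableAt (by simp)
  have hφd : MDifferentiableAt 𝓘(ℂ, CSpace n) 𝓘(ℂ, CSpace n) φ.symm (F w) :=
    (contMDiffAt_symm_of_mem_maximalAtlas hφ (φ.map_source hfw)).mdifferentiableAt (by simp)
  have hpt : φ.symm (F w) = f (χ.symm w) := φ.left_inv hfw
  have heq : f ∘ χ.symm =ᶠ[𝓝 w] φ.symm ∘ F := by
    have : ContinuousAt (f ∘ χ.symm) w :=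
      ContinuousAt.comp hfd.continuousAt hχd.continuousAt
    filter_upwards [this.eventually_mem (φ.open_source.mem_nhds hfw)] with w' hw'
    exact (φ.left_inv hw').symm
  have hder : ∀ v : CSpace m,
      (mfderiv 𝓘(ℂ, CSpace m) 𝓘(ℂ, CSpace n) f (χ.symm w)
        (mfderiv 𝓘(ℂ, CSpace m) 𝓘(ℂ, CSpace m) χ.symm w v) : CSpace n) =
      mfderiv 𝓘(ℂ, CSpace n) 𝓘(ℂ, CSpace n) φ.symm (F w) (fderiv ℂ F w v) := by
    intro v
    have h1 := mfderiv_comp w hfd hχd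
    have h2 := mfderiv_comp w hφd hF.differentiableAt.mdifferentiableAt
    rw [mfderiv_eq_fderiv] at h2
    have h3 := heq.mfderiv_eq (I := 𝓘(ℂ, CSpace m)) (I' := 𝓘(ℂ, CSpace n))
    have h4 : (mfderiv 𝓘(ℂ, CSpace m) 𝓘(ℂ, CSpace n) (f ∘ χ.symm) w : CSpace m →L[ℂ] CSpace n) v =
      (mfderiv 𝓘(ℂ, CSpace m) 𝓘(ℂ, CSpace n) (φ.symm ∘ F) w : CSpace m →L[ℂ] CSpace n) v :=
      congrArg (fun A : CSpace m →L[ℂ] CSpace n => A v) h3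
    rw [h1, h2] at h4
    exact h4
  have hform : ∀ {x y : N} (_ : x = y) (u v : CSpace n),
      (h.form x : CSpace n →ₗ[ℂ] CSpace n →ₗ⋆[ℂ] ℂ) u v =
        (h.form y : CSpace n →ₗ[ℂ] CSpace n →ₗ⋆[ℂ] ℂ) u v := by
    rintro x y rfl u v
    rfl
  rw [← h.form_mfderiv_symm φ (F w)]
  refine (hf.2 (χ.symm w) _ _).trans ?_
  refine (congrArg₂ (fun u v => (h.form (f (χ.symm w)) : CSpace n →ₗ[ℂ] CSpace n →ₗ⋆[ℂ] ℂ) u v)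
    (hder (Pi.single j 1)) (hder (Pi.single k 1))).trans ?_
  exact hform hpt.symm _ _

end kahler

end

theorem lemma3p2
    {n : ℕ} {N : Type*} [TopologicalSpace N] [ChartedSpace (CSpace n) N]
    [IsManifold 𝓘(ℂ, CSpace n) ω N] (h : KahlerMetric n N)
    (q : N) (φ : OpenPartialHomeomorph N (CSpace n))
    (hφ : φ ∈ HolomorphicCharts n N) (hq : q ∈ φ.source)
    {r : ℕ} (Ψ : CSpace n → ℝ) (ψ : Fin r → CSpace n → ℝ) (γ : Fin r → ℝ)
    (hΨ : Ψ ∈ NashDiastasisClass n (φ q))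
    (hΨpsh : StrictlyPlurisubharmonicAt Ψ (φ q))
    (hψ : ∀ i, ψ i ∈ NashDiastasisClass n (φ q))
    (hψpos : ∀ i, ∀ᶠ z in 𝓝 (φ q), 0 < ψ i z)
    (hD : h.IsDiastasisAt q φ (fun z => Ψ z + Real.log (∏ i, ψ i z ^ γ i)))
    {m : ℕ} {M : Type*} [TopologicalSpace M] [ChartedSpace (CSpace m) M]
    [IsManifold 𝓘(ℂ, CSpace m) ω M] (g : KahlerMetric m M) (f : M → N)
    (hf : IsHolomorphicIsometry g h f) (hqf : q ∈ Set.range f)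
    (hg : g.IsKahlerEinstein) :
    g.IsRicciFlat := by
  obtain ⟨c, hKE⟩ := hg
  suffices hc : 0 < m → c = 0 by
    intro χ hχ y hy
    rcases Nat.eq_zero_or_pos m with rfl | hm
    · exact Subsingleton.elim _ _
    · rw [hKE χ hχ y hy, hc hm, Complex.ofReal_zero, zero_smul]
  intro hm
  let j : Fin m := ⟨0, hm⟩
  obtain ⟨p, rfl⟩ := hqf
  let χ : OpenPartialHomeomorph M (CSpace m) := chartAt (CSpace m) p
  have hχ : χ ∈ HolomorphicCharts m M := IsManifold.chart_mem_maximalAtlas p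
  have hp : p ∈ χ.source := mem_chart_source _ p
  let w₀ : CSpace m := χ p
  have hw₀ : w₀ ∈ χ.target := χ.map_source hp
  let F : CSpace m → CSpace n := fun w => φ (f (χ.symm w))
  have hχp : χ.symm w₀ = p := χ.left_inv hp
  have hFw₀ : F w₀ = φ (f p) := by simp only [F, hχp]
  have hfw₀ : f (χ.symm w₀) ∈ φ.source := by rwa [hχp]
  have hF : AnalyticAt ℂ F w₀ := analyticAt_in_charts hf.1 hχ hφ hw₀ hfw₀
  rw [← hFw₀] at hΨ hΨpsh hψ hψpos
  obtain ⟨T, hT, hTh⟩ := hD.exists_extension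
  rw [← hFw₀] at hT hTh
  have hnear : ∀ᶠ w in 𝓝 w₀, w ∈ χ.target ∧ f (χ.symm w) ∈ φ.source := by
    have hc : ContinuousAt (fun w => f (χ.symm w)) w₀ :=
      ContinuousAt.comp (g := f) hf.1.continuous.continuousAt (χ.continuousAt_symm hw₀)
    exact (χ.open_target.eventually_mem hw₀).and
      (hc.eventually_mem (φ.open_source.mem_nhds hfw₀))
  -- the diastasis, pulled back, is a potential of `g`
  let u : CSpace m → ℝ := fun w => Ψ (F w) + Real.log (∏ i, ψ i (F w) ^ γ i)
  have hu : ∀ᶠ w in 𝓝 w₀, g.form.matrix χ w = complexHessian u w := by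
    filter_upwards [hnear, hF.eventually_analyticAt, hF.continuousAt.eventually hTh,
      hF.continuousAt.eventually hT.eventually] with w h1 h2 h3 h4
    ext j k
    rw [hf.matrix_eq hχ hφ h1.1 h1.2 j k, h3]
    exact (h4.complexHessian_comp h2 j k).symm
  have hv : ∀ᶠ w in 𝓝 w₀, Real.log (g.form.matrix χ w).det.re =
      Real.log (complexHessian u w).det.re := by
    filter_upwards [hu] with w hw
    rw [hw]
  refine eq_zero_of_complexHessian_log_det (Ψ := fun w => Ψ (F w)) (ψ := fun i w => ψ i (F w))
    (NashDiastasisClass.comp hΨ hF) (fun i => NashDiastasisClass.comp (hψ i) hF)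
    (fun i => hF.continuousAt.eventually (hψpos i)) (u := u) (Filter.Eventually.of_forall fun _ => rfl)
    ?_ hv j ?_ ?_
  · filter_upwards [hu, hnear] with w h1 h2
    rw [← h1]
    exact g.det_matrix_pos hχ h2.1
  · filter_upwards [hu, hnear] with w h1 h2
    rw [← h1]
    have := congrArg (fun A => A j j) (hKE χ hχ w h2.1)
    simp only [KahlerMetric.ricci, Matrix.neg_apply, Matrix.smul_apply, smul_eq_mul] at this
    linear_combination -this
  · have hne : fderiv ℂ F w₀ (Pi.single j 1) ≠ 0 := by
      intro h0
      refine g.matrix_diag_ne_zero hχ hw₀ j ?_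
      rw [hf.matrix_eq hχ hφ hw₀ hfw₀]
      change ∑ l, ∑ i, _ * fderiv ℂ F w₀ (Pi.single j 1) l * _ = 0
      simp [h0]
    obtain ⟨-, T', hT', -, -⟩ := hΨ
    rw [hT'.complexHessian_comp hF]
    intro h0
    have := hΨpsh.2 _ hne
    rw [h0] at this
    simp at this
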